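/- Let $k\ge 0$, let $n_0,\dots,n_k\ge 0$ be integers, and put $\mathbb{C}[\varepsilon_i]=\mathbb{C}[X]/(X^{n_i+1})$, where $\varepsilon_i$ is the class of $X$. Let $t_0,\dots,t_k\in\mathbb{C}\setminus\{0,1\}$ be pairwise distinct and let $x\in\mathbb{C}\setminus\{0,1,t_0,\dots,t_k\}$. For $s\in\mathbb{C}\setminus\{0,1,x\}$ let \[g_{t_i+\varepsilon_i,x}(s)=\begin{pmatrix}-(s-1)x & (t_i+\varepsilon_i)s(s-1)\\ -(s-x) & s(s-x)\end{pmatrix}\in \mathrm{PGL}_2(\mathbb{C}[\varepsilon_i]),\qquad g_{s,x}=\bigl(g_{t_i+\varepsilon_i,x}(s)\bigr)_{0\le i\le k}\in \mathbf{G}=\prod_{i=0}^k \mathrm{PGL}_2(\mathbb{C}[\varepsilon_i]).\] (a) The elements $g_{s,x}$, $s\in\mathbb{C}\setminus\{0,1,x\}$, generate a dense subgroup of the complex Lie group $\mathbf{G}$ (in its usual topology, coming from that of $\mathbb{C}$). (b) Let $m=1+\sum_{i=0}^k (n_i+1)$ and $N=4m$. Then the rational map $\phi_N:\mathbb{A}^N_{\mathbb{C}}\dashrightarrow\mathbf{G}$,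 $(s_1,\dots,s_N)\mapsto g_{s_1,x}\cdots g_{s_N,x}$, defined where all $s_j\notin\{0,1,x\}$, is dominant: its image is Zariski-dense in $\mathbf{G}$, regarded as an algebraic group over $\mathbb{C}$ of dimension $3\sum_{i=0}^k (n_i+1)$. -/

import Mathlib

open scoped MatrixGroups Polynomial

noncomputable section

namespace WildHecke

/-- The truncated polynomial ring `ℂ[ε] = ℂ[X] / (X ^ (n + 1))`. -/
abbrev TruncPoly (n : ℕ) : Type := AdjoinRoot (Polynomial.X ^ (n + 1) : ℂ[X])

/-- The class `ε` of `X`. -/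
def eps (n : ℕ) : TruncPoly n := AdjoinRoot.root _

/-- Inclusion of constants `ℂ → ℂ[ε]`. -/
def const (n : ℕ) : ℂ →+* TruncPoly n := AdjoinRoot.of _

/-- The coefficients `(u₀, …, uₙ)` of `u = u₀ + u₁ ε + ⋯ + uₙ ε ^ n`. -/
def coeffs (n : ℕ) (u : TruncPoly n) (j : Fin (n + 1)) : ℂ :=
  (AdjoinRoot.modByMonicHom (Polynomial.monic_X_pow (n + 1)) u).coeff j

/-- The usual topology of `ℂ[ε]`, identified with `ℂ ^ (n + 1)` through the coefficients. -/
instance (n : ℕ) : TopologicalSpace (TruncPoly n) :=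
  TopologicalSpace.induced (coeffs n) inferInstance

/-- The usual topology of `PGL₂(R)` for a topological ring `R`: the quotient topology of `GL₂(R)`,
which is the unit group of the topological monoid of `2 × 2` matrices. For `R = ℂ[ε]` this is the
topology of the (complex) Lie group `PGL₂(ℂ[ε])`. -/
instance (R : Type*) [CommRing R] [TopologicalSpace R] : TopologicalSpace PGL(2, R) :=
  TopologicalSpace.coinduced (Matrix.ProjGenLinGroup.mk : GL (Fin 2) R → PGL(2, R)) inferInstance

/-- The matrix `g_{t + ε, x}(s)`. -/
def gMatrix (n : ℕ) (t x s : ℂ) : Matrix (Fin 2) (Fin 2) (TruncPoly n) :=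
  !![const n (-(s - 1) * x), (const n t + eps n) * const n (s * (s - 1));
     const n (-(s - x)), const n (s * (s - x))]

theorem eps_pow (n : ℕ) : eps n ^ (n + 1) = 0 := by
  have h := AdjoinRoot.mk_self (f := (Polynomial.X ^ (n + 1) : ℂ[X]))
  rwa [map_pow, AdjoinRoot.mk_X] at h

theorem isUnit_det_gMatrix (n : ℕ) {t x s : ℂ} (hxt : x ≠ t) (h0 : s ≠ 0) (h1 : s ≠ 1)
    (hx : s ≠ x) : IsUnit (gMatrix n t x s).det := by
  have hdet : (gMatrix n t x s).det
      = const n (s * (s - 1) * (s - x)) * (const n (t - x) + eps n) := by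
    simp only [gMatrix, Matrix.det_fin_two_of, map_mul, map_sub, map_neg, map_one]
    ring
  rw [hdet]
  have hnil : IsNilpotent (eps n) := ⟨n + 1, eps_pow n⟩
  have hu : IsUnit (const n (t - x)) := (sub_ne_zero.2 hxt.symm).isUnit.map (const n)
  refine IsUnit.mul ?_ (hnil.isUnit_add_left_of_commute hu (Commute.all _ _))
  exact (mul_ne_zero (mul_ne_zero h0 (sub_ne_zero.2 h1)) (sub_ne_zero.2 hx)).isUnit.map (const n)

/-- The parameters `s ∈ ℂ ∖ {0, 1, x}`. -/
abbrev Param (x : ℂ) : Type := {s : ℂ // s ≠ 0 ∧ s ≠ 1 ∧ s ≠ x}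

/-- The element `g_{t + ε, x}(s)` of `PGL₂(ℂ[ε])`. -/
def g (n : ℕ) (t x : ℂ) (hxt : x ≠ t) (s : Param x) : PGL(2, TruncPoly n) :=
  Matrix.ProjGenLinGroup.mk (Matrix.GeneralLinearGroup.mk'' (gMatrix n t x s)
    (isUnit_det_gMatrix n hxt s.2.1 s.2.2.1 s.2.2.2))

/-- The group `∏ᵢ PGL₂(ℂ[εᵢ])`, where `ℂ[εᵢ] = ℂ[X] / (X ^ (nᵢ + 1))`, for `i = 0, …, k`.
As a product it carries the product topology (of the usual topologies). -/
abbrev ProdPGL {k : ℕ} (n : Fin (k + 1) → ℕ) : Type := ∀ i, PGL(2, TruncPoly (n i))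

/-- The element `g_{s, x} = (g_{tᵢ + εᵢ, x}(s))ᵢ`. -/
def gTuple {k : ℕ} (n : Fin (k + 1) → ℕ) (t : Fin (k + 1) → ℂ) (x : ℂ) (hx : ∀ i, x ≠ t i)
    (s : Param x) : ProdPGL n :=
  fun i => g (n i) (t i) x (hx i) s

/-- The map `(s₁, …, s_N) ↦ g_{s₁, x} ⋯ g_{s_N, x}`, on the dense open subset of affine space
`𝔸 ^ N` where no coordinate is `0`, `1` or `x`. -/
def phi {k : ℕ} (n : Fin (k + 1) → ℕ) (t : Fin (k + 1) → ℂ) (x : ℂ) (hx : ∀ i, x ≠ t i)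
    (N : ℕ) (s : Fin N → Param x) : ProdPGL n :=
  (List.ofFn fun j => gTuple n t x hx (s j)).prod

/-- The Zariski topology of the affine space `ℂ ^ σ`: it is induced by the map that sends a point
to its maximal ideal. The closed sets are the zero loci of sets of polynomials. -/
@[reducible]
def zariskiAffine (σ : Type) : TopologicalSpace (σ → ℂ) :=
  TopologicalSpace.induced
    (MvPolynomial.pointToPoint : (σ → ℂ) → PrimeSpectrum (MvPolynomial σ ℂ)) inferInstance

/-- The index set of the complex coordinates on `∏ᵢ Mat₂(ℂ[εᵢ])`: a factor, a matrix entry, and a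
power of `εᵢ`. -/
abbrev Coord {k : ℕ} (n : Fin (k + 1) → ℕ) : Type :=
  Σ i : Fin (k + 1), Fin 2 × Fin 2 × Fin (n i + 1)

/-- The coordinates of an element of `∏ᵢ GL₂(ℂ[εᵢ])`; they identify this group with a principal
open subset (the non-vanishing of all constant terms of determinants) of an affine space. -/
def coords {k : ℕ} (n : Fin (k + 1) → ℕ) (A : ∀ i, GL (Fin 2) (TruncPoly (n i))) :
    Coord n → ℂ :=
  fun c => coeffs (n c.1) ((A c.1 : Matrix (Fin 2) (Fin 2) (TruncPoly (n c.1))) c.2.1 c.2.2.1)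
    c.2.2.2

/-- The Zariski topology of `∏ᵢ GL₂(ℂ[εᵢ])`, as a subvariety of affine space. -/
@[reducible]
def zariskiProdGL {k : ℕ} (n : Fin (k + 1) → ℕ) :
    TopologicalSpace (∀ i, GL (Fin 2) (TruncPoly (n i))) :=
  TopologicalSpace.induced (coords n) (zariskiAffine (Coord n))

/-- The Zariski topology of the algebraic group `∏ᵢ PGL₂(ℂ[εᵢ])` over `ℂ`: it is the quotient
variety of `∏ᵢ GL₂(ℂ[εᵢ])` by its algebraic subgroup of scalar matrices, and has the quotient
topology. -/
@[reducible]
def zariskiProdPGL {k : ℕ} (n : Fin (k + 1) → ℕ) : TopologicalSpace (ProdPGL n) :=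
  TopologicalSpace.coinduced
    (fun (A : ∀ i, GL (Fin 2) (TruncPoly (n i))) i => Matrix.ProjGenLinGroup.mk (A i))
    (zariskiProdGL n)

end WildHecke

end

open Filter Topology

noncomputable section

namespace WildHecke

/-! Put R = ∏ ℂ[εᵢ] and y = (tᵢ + εᵢ)ᵢ. Since the tᵢ are distinct, y generates R as a ℂ-algebra
(`adjoin_piParam`), so all factors can be treated at once in GL₂(R).

Density. A closed subgroup containing all quotients g(s) g(s')⁻¹ is shown to be everything
(`eq_top_of_isClosed`). In a suitable basis, limits of these quotients for s, s' → 1 give the torus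
diag(l, 1) (`torus_mem`). Conjugating g(s) g(s')⁻¹ by a diverging torus element while s' → s gives
unipotents (`upper_mem`, `lower_mem`). The upper and lower unipotents in the subgroup form
ℂ-subspaces U, L of R with U·U·L ⊆ U and L·L·U ⊆ L. They contain units e ∈ U and z ∈ L, and also zy
∈ L, which forces U = L = R (`upper_eq_top`, `lower_eq_top`). Elementary and scalar matrices
generate GL₂(R), because R has stable range one and its units are squares (`mem_of_isUnit_det`).

Dominance. Let S_N be the cone of matrices representing products of N curve elements. Each vanishing
ideal is prime, as S_{N+1} sweeps S_N along a polynomial curve of linear maps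
(`isPrime_vanishingIdeal_iUnion`). The height of the ideal cannot drop more often than the dimension
4∑(nᵢ+1) allows, so for some N within this bound the Zariski closure of S_{N+1} is the translate of
that of S_N by every g(s) (`exists_vanishingIdeal_eq`). The closure of S_N is then stable under all
g(s) g(s')⁻¹. It defines a locus closed in the usual topology, so the density just proved makes it
everything (`exists_coneLocus_eq_univ`). -/

/-! ### Generation of GL₂ by elementary and scalar matrices -/

theorem matrix_two_congr {R : Type*} {a b c d a' b' c' d' : R} (ha : a = a') (hb : b = b')
    (hc : c = c') (hd : d = d') : !![a, b; c, d] = !![a', b'; c', d'] := by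
  rw [ha, hb, hc, hd]

theorem continuous_matrix_two {X R : Type*} [TopologicalSpace X] [TopologicalSpace R]
    {a b c d : X → R} (ha : Continuous a) (hb : Continuous b) (hc : Continuous c)
    (hd : Continuous d) : Continuous fun u => !![a u, b u; c u, d u] := by
  refine continuous_matrix fun i j => ?_
  fin_cases i <;> fin_cases j <;> simpa

/-- A submonoid of matrices that contains all elementary and all scalar invertible matrices
contains all invertible matrices, if `R` has stable range one and all units are squares. -/
theorem mem_of_isUnit_det {R : Type*} [CommRing R]
    {P : Submonoid (Matrix (Fin 2) (Fin 2) R)}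
    (hsr : ∀ a c : R, IsCoprime a c → ∃ r, IsUnit (a + r * c))
    (hsq : ∀ u : R, IsUnit u → ∃ w, w ^ 2 = u)
    (hS : ∀ u : R, IsUnit u → !![u, 0; 0, u] ∈ P)
    (hU : ∀ q : R, !![1, q; 0, 1] ∈ P) (hL : ∀ r : R, !![1, 0; r, 1] ∈ P)
    {A : Matrix (Fin 2) (Fin 2) R} (hA : IsUnit A.det) : A ∈ P := by
  -- The word is w(a) w(-1), where w(a) = [0, a; -a⁻¹, 0] is a product of three elementary matrices.
  have hdiag : ∀ a b : R, a * b = 1 → !![a, 0; 0, b] ∈ P := fun a b hab => by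
    have := P.mul_mem (P.mul_mem (P.mul_mem (P.mul_mem (P.mul_mem (hU a) (hL (-b))) (hU a))
      (hU (-1))) (hL 1)) (hU (-1))
    convert this using 1
    simp only [Matrix.mul_fin_two]
    refine matrix_two_congr ?_ ?_ ?_ ?_
    · linear_combination a * hab
    · linear_combination -hab
    · linear_combination hab
    · ring
  have hdet1 : ∀ a b c d : R, a * d - b * c = 1 → !![a, b; c, d] ∈ P := fun a b c d h => by
    -- Stable range one: adding r times the second row to the first makes the corner a unit, after
    -- which the matrix has an LDU factorization.
    obtain ⟨r, hr⟩ := hsr a c ⟨d, -b, by linear_combination h⟩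
    obtain ⟨u, hu⟩ := hr
    have h1 : (u : R) * ↑u⁻¹ = 1 := u.mul_inv
    have := P.mul_mem (P.mul_mem (P.mul_mem (hU (-r)) (hL (c * ↑u⁻¹))) (hdiag u ↑u⁻¹ h1))
      (hU (↑u⁻¹ * (b + r * d)))
    convert this using 1
    simp only [Matrix.mul_fin_two]
    generalize (↑u⁻¹ : R) = v at *
    have hd : c * v * (b + r * d) + v = d := by
      linear_combination d * h1 - v * h - v * d * hu
    refine matrix_two_congr ?_ ?_ ?_ ?_
    · linear_combination -hu + (r * c) * h1
    · linear_combination -(b + r * d) * h1 + r * hd + (r * c * v * (b + r * d)) * h1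
    · linear_combination -c * h1
    · linear_combination -hd - (c * v * (b + r * d)) * h1
  obtain ⟨w, hw⟩ := hsq _ hA
  have hwu : IsUnit w := by
    -- Dividing A by a square root w of its determinant reduces to determinant one.
    rw [← hw] at hA
    exact (isUnit_pow_iff two_ne_zero).1 hA
  obtain ⟨u, rfl⟩ := hwu
  have h1 : (u : R) * ↑u⁻¹ = 1 := u.mul_inv
  have := P.mul_mem (hS u u.isUnit) (hdet1 (↑u⁻¹ * A 0 0) (↑u⁻¹ * A 0 1) (↑u⁻¹ * A 1 0)
    (↑u⁻¹ * A 1 1) (by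
      rw [Matrix.det_fin_two] at hw
      linear_combination -(↑u⁻¹ : R) ^ 2 * hw + (↑u⁻¹ * (u : R) + 1) * h1))
  convert this using 1
  rw [Matrix.mul_fin_two, Matrix.eta_fin_two A]
  refine matrix_two_congr ?_ ?_ ?_ ?_ <;> simp [← mul_assoc]

/-! ### Unipotent elements in a limit-closed monoid containing a torus -/

section MatrixLimits

variable {R : Type*} [CommRing R] [Algebra ℂ R]

local notation "κ" => algebraMap ℂ R

/-- A set of matrices over `R` is closed under limits of continuous curves whose determinant is,
up to a constant unit, a complex-valued function that does not vanish in the limit. -/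
def LimitClosed [TopologicalSpace R] (P : Submonoid (Matrix (Fin 2) (Fin 2) R)) : Prop :=
  ∀ (F : ℂ → Matrix (Fin 2) (Fin 2) R) (d : ℂ → ℂ) (c : R), Continuous F → Continuous d →
    d 0 ≠ 0 → IsUnit c → (∀ δ, (F δ).det = κ (d δ) * c) → (∀ᶠ δ in 𝓝[≠] 0, F δ ∈ P) → F 0 ∈ P

theorem conj_torus_mem {P : Submonoid (Matrix (Fin 2) (Fin 2) R)}
    (hT : ∀ l : ℂ, l ≠ 0 → !![κ l, 0; 0, 1] ∈ P) {l : ℂ} (hl : l ≠ 0) {a b c d : R}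
    (h : !![a, b; c, d] ∈ P) : !![a, κ l * b; κ l⁻¹ * c, d] ∈ P := by
  have h1 : κ l * κ l⁻¹ = 1 := by rw [← map_mul, mul_inv_cancel₀ hl, map_one]
  have := P.mul_mem (P.mul_mem (hT l hl) h) (hT l⁻¹ (inv_ne_zero hl))
  convert this using 1
  simp only [Matrix.mul_fin_two]
  refine matrix_two_congr ?_ ?_ ?_ ?_
  · linear_combination -a * h1
  all_goals ring

/-- The `q` such that the unipotent matrix with upper right entry `q` belongs to `P`. -/
def upper (P : Submonoid (Matrix (Fin 2) (Fin 2) R))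
    (hT : ∀ l : ℂ, l ≠ 0 → !![κ l, 0; 0, 1] ∈ P) : Submodule ℂ R where
  carrier := {q | !![1, q; 0, 1] ∈ P}
  zero_mem' := by simp [← Matrix.one_fin_two]
  add_mem' {a b} ha hb := by
    have := P.mul_mem ha hb
    simpa [add_comm] using this
  smul_mem' l q hq := by
    by_cases hl : l = 0
    · simp [hl, ← Matrix.one_fin_two]
    · simpa [Algebra.smul_def] using conj_torus_mem hT hl hq

/-- The `r` such that the unipotent matrix with lower left entry `r` belongs to `P`. -/
def lower (P : Submonoid (Matrix (Fin 2) (Fin 2) R))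
    (hT : ∀ l : ℂ, l ≠ 0 → !![κ l, 0; 0, 1] ∈ P) : Submodule ℂ R where
  carrier := {r | !![1, 0; r, 1] ∈ P}
  zero_mem' := by simp [← Matrix.one_fin_two]
  add_mem' {a b} ha hb := by
    have := P.mul_mem ha hb
    simpa [add_comm] using this
  smul_mem' l q hq := by
    by_cases hl : l = 0
    · simp [hl, ← Matrix.one_fin_two]
    · simpa [Algebra.smul_def] using conj_torus_mem hT (inv_ne_zero hl) hq

section

variable {P : Submonoid (Matrix (Fin 2) (Fin 2) R)}

theorem mem_upper (hT : ∀ l : ℂ, l ≠ 0 → !![κ l, 0; 0, 1] ∈ P) {q : R} : q ∈ upper P hT ↔ !![1, q; 0, 1] ∈ P := Iff.rfl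

theorem mem_lower (hT : ∀ l : ℂ, l ≠ 0 → !![κ l, 0; 0, 1] ∈ P) {r : R} : r ∈ lower P hT ↔ !![1, 0; r, 1] ∈ P := Iff.rfl

variable [TopologicalSpace R] [IsTopologicalRing R] [ContinuousSMul ℂ R]

/-- Conjugate the upper unipotent of δq by the lower unipotent of r, then by diag(δ, 1). The upper
right entry becomes δ²q and the lower left entry stays -r²q, so the limit δ → 0 is lower unipotent.
-/
theorem sq_mul_mem_lower (hT : ∀ l : ℂ, l ≠ 0 → !![κ l, 0; 0, 1] ∈ P)
    (hP : LimitClosed P) {q r : R} (hq : q ∈ upper P hT)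
    (hr : r ∈ lower P hT) : r ^ 2 * q ∈ lower P hT := by
  have hc : Continuous κ := continuous_algebraMap ℂ R
  have key := hP (fun δ => !![1 + κ δ * (q * r), κ δ ^ 2 * q; -(r ^ 2 * q), 1 - κ δ * (q * r)])
    (fun _ => 1) 1
    (continuous_matrix_two (by fun_prop) (by fun_prop) (by fun_prop) (by fun_prop))
    continuous_const one_ne_zero isUnit_one
    (fun δ => by simp only [Matrix.det_fin_two_of, map_one]; ring) ?_
  · rw [← neg_mem_iff, mem_lower]
    simpa using key
  · filter_upwards [self_mem_nhdsWithin] with δ hδ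
    have hδ : δ ≠ 0 := hδ
    have h1 : κ δ * κ δ⁻¹ = 1 := by rw [← map_mul, mul_inv_cancel₀ hδ, map_one]
    have h2 : !![1, κ δ * q; 0, 1] ∈ P := by
      simpa [Algebra.smul_def] using (mem_upper hT).1 ((upper P hT).smul_mem δ hq)
    have := P.mul_mem (P.mul_mem ((mem_lower hT).1 (neg_mem hr)) h2) hr
    simp only [Matrix.mul_fin_two] at this
    convert conj_torus_mem hT hδ this using 1
    refine matrix_two_congr (by ring) (by ring) ?_ (by ring)
    linear_combination (r ^ 2 * q) * h1

theorem sq_mul_mem_upper (hT : ∀ l : ℂ, l ≠ 0 → !![κ l, 0; 0, 1] ∈ P)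
    (hP : LimitClosed P) {q r : R} (hq : q ∈ upper P hT)
    (hr : r ∈ lower P hT) : q ^ 2 * r ∈ upper P hT := by
  have hc : Continuous κ := continuous_algebraMap ℂ R
  have key := hP (fun δ => !![1 - κ δ * (q * r), -(q ^ 2 * r); κ δ ^ 2 * r, 1 + κ δ * (q * r)])
    (fun _ => 1) 1
    (continuous_matrix_two (by fun_prop) (by fun_prop) (by fun_prop) (by fun_prop))
    continuous_const one_ne_zero isUnit_one
    (fun δ => by simp only [Matrix.det_fin_two_of, map_one]; ring) ?_
  · rw [← neg_mem_iff, mem_upper]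
    simpa using key
  · filter_upwards [self_mem_nhdsWithin] with δ hδ
    have hδ : δ ≠ 0 := hδ
    have h1 : κ δ * κ δ⁻¹ = 1 := by rw [← map_mul, mul_inv_cancel₀ hδ, map_one]
    have h2 : !![1, 0; κ δ * r, 1] ∈ P := by
      simpa [Algebra.smul_def] using (mem_lower hT).1 ((lower P hT).smul_mem δ hr)
    have := P.mul_mem (P.mul_mem ((mem_upper hT).1 (neg_mem hq)) h2) hq
    simp only [Matrix.mul_fin_two] at this
    convert conj_torus_mem hT (inv_ne_zero hδ) this using 1
    rw [inv_inv]
    refine matrix_two_congr (by ring) ?_ (by ring) (by ring)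
    linear_combination (q ^ 2 * r) * h1

/-- Polarization of the quadratic map r ↦ r²q. -/
theorem mul_mul_mem_lower (hT : ∀ l : ℂ, l ≠ 0 → !![κ l, 0; 0, 1] ∈ P)
    (hP : LimitClosed P) {q r r' : R} (hq : q ∈ upper P hT)
    (hr : r ∈ lower P hT) (hr' : r' ∈ lower P hT) : r * r' * q ∈ lower P hT := by
  have := (lower P hT).smul_mem (2⁻¹ : ℂ) (sub_mem (sub_mem
    (sq_mul_mem_lower hT hP hq (add_mem hr hr')) (sq_mul_mem_lower hT hP hq hr))
    (sq_mul_mem_lower hT hP hq hr'))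
  rwa [show (r + r') ^ 2 * q - r ^ 2 * q - r' ^ 2 * q = (2 : ℂ) • (r * r' * q) by
    rw [two_smul]; ring, smul_smul, inv_mul_cancel₀ two_ne_zero, one_smul] at this

theorem mul_mul_mem_upper (hT : ∀ l : ℂ, l ≠ 0 → !![κ l, 0; 0, 1] ∈ P)
    (hP : LimitClosed P) {q q' r : R} (hq : q ∈ upper P hT)
    (hq' : q' ∈ upper P hT) (hr : r ∈ lower P hT) : q * q' * r ∈ upper P hT := by
  have := (upper P hT).smul_mem (2⁻¹ : ℂ) (sub_mem (sub_mem
    (sq_mul_mem_upper hT hP (add_mem hq hq') hr) (sq_mul_mem_upper hT hP hq hr))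
    (sq_mul_mem_upper hT hP hq' hr))
  rwa [show (q + q') ^ 2 * r - q ^ 2 * r - q' ^ 2 * r = (2 : ℂ) • (q * q' * r) by
    rw [two_smul]; ring, smul_smul, inv_mul_cancel₀ two_ne_zero, one_smul] at this

/-- If the Jordan pair of unipotent elements contains a pair of units, and multiples of these by a
generator of `R`, then it contains everything. -/
theorem upper_eq_top [Module.Finite ℂ R]
    (hT : ∀ l : ℂ, l ≠ 0 → !![κ l, 0; 0, 1] ∈ P) (hP : LimitClosed P) {e z y : R}
    (hy : Algebra.adjoin ℂ {y} = ⊤)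
    (he : e ∈ upper P hT) (hue : IsUnit e) (hz : z ∈ lower P hT) (huz : IsUnit z)
    (hzy : z * y ∈ lower P hT) : upper P hT = ⊤ := by
  set W := upper P hT
  have hact : ∀ r ∈ lower P hT, ∀ q ∈ W, (e * r) * q ∈ W := fun r hr q hq => by
    have := mul_mul_mem_upper hT hP he hq hr
    rwa [show e * q * r = e * r * q by ring] at this
  -- Multiplication by the unit ez is injective and maps the finite-dimensional space W into itself,
  -- hence onto. Writing q = ezq' turns yq into e(zy)q', which is how stability under y follows.
  have hmap : W.map (LinearMap.mulLeft ℂ (e * z)) = W := by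
    refine Submodule.eq_of_le_of_finrank_eq ?_ ?_
    · rintro _ ⟨q, hq, rfl⟩
      exact hact z hz q hq
    · exact LinearEquiv.finrank_eq (Submodule.equivMapOfInjective (LinearMap.mulLeft ℂ (e * z))
        (fun a b h => (hue.mul huz).mul_left_cancel h) W).symm
  have hyW : ∀ q ∈ W, y * q ∈ W := fun q hq => by
    rw [← hmap] at hq
    obtain ⟨q', hq', rfl⟩ := hq
    have := hact _ hzy q' hq'
    simpa [mul_assoc, mul_comm, mul_left_comm] using this
  have hall : ∀ a : R, ∀ q ∈ W, a * q ∈ W := fun a => by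
    have ha : a ∈ Algebra.adjoin ℂ {y} := by rw [hy]; trivial
    induction ha using Algebra.adjoin_induction with
    | mem a ha => rw [Set.mem_singleton_iff.1 ha]; exact hyW
    | algebraMap c => exact fun q hq => by simpa [Algebra.smul_def] using W.smul_mem c hq
    | add a b _ _ ha hb => exact fun q hq => by rw [add_mul]; exact add_mem (ha q hq) (hb q hq)
    | mul a b _ _ ha hb => exact fun q hq => by rw [mul_assoc]; exact ha _ (hb q hq)
  refine eq_top_iff.2 fun a _ => ?_
  obtain ⟨u, rfl⟩ := hue
  simpa using hall (a * ↑u⁻¹) _ he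

/-- With a unit u ∈ L and U = R, every a equals u · u · (u⁻²a). -/
theorem lower_eq_top (hT : ∀ l : ℂ, l ≠ 0 → !![κ l, 0; 0, 1] ∈ P)
    (hP : LimitClosed P) {z : R} (hU : upper P hT = ⊤)
    (hz : z ∈ lower P hT) (huz : IsUnit z) : lower P hT = ⊤ := by
  refine eq_top_iff.2 fun a _ => ?_
  obtain ⟨u, rfl⟩ := huz
  have := mul_mul_mem_lower hT hP (q := ↑u⁻¹ * ↑u⁻¹ * a) (by rw [hU]; trivial) hz hz
  rwa [show (u : R) * u * (↑u⁻¹ * ↑u⁻¹ * a) = (u * ↑u⁻¹) * (u * ↑u⁻¹) * a by ring, u.mul_inv,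
    one_mul, one_mul] at this

end

end MatrixLimits

/-! ### Limits along the curve s ↦ g(s) -/

theorem eventually_shift_ne (s x : ℂ) (l : ℂ) (hl : l ≠ 0) :
    ∀ᶠ δ in 𝓝[≠] (0 : ℂ), s + l * δ ≠ x := by
  have hf : ({(x - s) / l} : Set ℂ)ᶜ ∈ 𝓝[≠] (0 : ℂ) := by
    by_cases h0 : (x - s) / l = 0
    · rw [h0]; exact self_mem_nhdsWithin
    · exact mem_nhdsWithin_of_mem_nhds ((isOpen_compl_singleton).mem_nhds (Ne.symm h0))
  filter_upwards [hf] with δ hδ h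
  apply hδ
  rw [Set.mem_singleton_iff, eq_div_iff hl]
  linear_combination h

/-- Conjugate of a submonoid of matrices. -/
def conjSubmonoid {R : Type*} [CommRing R] (h : GL (Fin 2) R)
    (P : Submonoid (Matrix (Fin 2) (Fin 2) R)) : Submonoid (Matrix (Fin 2) (Fin 2) R) where
  carrier := {A | h.val * A * h⁻¹.val ∈ P}
  one_mem' := by simp
  mul_mem' {A B} hA hB := by
    have := P.mul_mem hA hB
    rwa [show h.val * A * h⁻¹.val * (h.val * B * h⁻¹.val)
      = h.val * A * (h⁻¹.val * h.val) * B * h⁻¹.val by simp only [mul_assoc], ← Units.val_mul,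
      inv_mul_cancel, Units.val_one, mul_one, mul_assoc h.val A B] at this

section

variable {R : Type*} [CommRing R] [Algebra ℂ R]

local notation "κ" => algebraMap ℂ R

omit [Algebra ℂ R] in
theorem mem_conjSubmonoid {h : GL (Fin 2) R} {P : Submonoid (Matrix (Fin 2) (Fin 2) R)}
    {A : Matrix (Fin 2) (Fin 2) R} : A ∈ conjSubmonoid h P ↔ h.val * A * h⁻¹.val ∈ P := Iff.rfl

/-- The matrix `g_{y, x}(s)` over a `ℂ`-algebra. -/
def curveMatrix (x : ℂ) (y : R) (s : ℂ) : Matrix (Fin 2) (Fin 2) R :=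
  !![κ (-(s - 1) * x), y * κ (s * (s - 1)); κ (-(s - x)), κ (s * (s - x))]

theorem curveMatrix_mul_adjugate (x : ℂ) (y : R) (s s' : ℂ) :
    curveMatrix x y s * (curveMatrix x y s').adjugate =
      !![κ ((s - 1) * (s' - x)) * (y * κ s - κ (x * s')),
        κ (x * ((s - 1) * (s' - 1))) * y * κ (s' - s);
        κ (-((s - x) * (s' - x))) * κ (s' - s),
        κ ((s - x) * (s' - 1)) * (y * κ s' - κ (x * s))] := by
  rw [curveMatrix, curveMatrix, Matrix.adjugate_fin_two_of, Matrix.mul_fin_two]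
  simp only [map_mul, map_neg, map_sub, map_one]
  refine matrix_two_congr ?_ ?_ ?_ ?_ <;> ring

theorem LimitClosed.conj [TopologicalSpace R] [IsTopologicalRing R]
    {P : Submonoid (Matrix (Fin 2) (Fin 2) R)} (hP : LimitClosed P)
    (h : GL (Fin 2) R) : LimitClosed (conjSubmonoid h P) := by
  intro F d c hF hd h0 hc hdet hmem
  refine hP (fun δ => h.val * F δ * h⁻¹.val) d c (by fun_prop) hd h0 hc (fun δ => ?_) hmem
  rw [Matrix.det_mul, Matrix.det_mul, mul_right_comm, ← Matrix.det_mul, ← Units.val_mul,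
    mul_inv_cancel, Units.val_one, Matrix.det_one, one_mul, hdet]

/-- The outer factors are v h⁻¹ and h, where the columns (v, 1 - x) and (0, 1) of h are common
eigenvectors of the limits at s, s' → 1. Both off-diagonal entries carry a factor e, since the
product is scalar when s' = s; this factor is what the later rescalings cancel. -/
theorem conj_curveMatrix_mul_adjugate (x : ℂ) (y v : R) (hv : y = v + κ x) (s e : ℂ) :
    !![1, 0; -κ (1 - x), v] * (curveMatrix x y s * (curveMatrix x y (s + e)).adjugate) *
      !![v, 0; κ (1 - x), 1] =
    !![(κ s - 1) * (κ s + κ e - κ x) * (v * κ s - κ x * κ e) * v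
        + κ e * (κ x * y * (κ s - 1) * (κ s + κ e - 1)) * (1 - κ x),
      κ e * (κ x * y * (κ s - 1) * (κ s + κ e - 1));
      κ e * (-v ^ 2 * (κ s - κ x) * (κ s + κ e - κ x)
        + v * (1 - κ x) * ((κ s - κ x) * ((κ s - 1) * y + κ s * v + y * κ e)
          - (κ s - 1) * (-(κ s - κ x) * κ x + κ s * v - κ x * κ e))
        - (1 - κ x) ^ 2 * (κ x * y * (κ s - 1) * (κ s + κ e - 1))),
      v * ((κ s - κ x) * (κ s + κ e - 1) * (v * κ s + y * κ e))
        - (1 - κ x) * κ e * (κ x * y * (κ s - 1) * (κ s + κ e - 1))] := by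
  rw [curveMatrix_mul_adjugate, Matrix.mul_fin_two, Matrix.mul_fin_two, hv]
  simp only [map_mul, map_neg, map_sub, map_one, map_add]
  refine matrix_two_congr ?_ ?_ ?_ ?_ <;> ring

omit [Algebra ℂ R] in
theorem mem_of_mul_mem {Q : Submonoid (Matrix (Fin 2) (Fin 2) R)}
    (hS : ∀ (u : R) (A : Matrix (Fin 2) (Fin 2) R), IsUnit u → A ∈ Q → u • A ∈ Q)
    {u a b c d : R} (hu : IsUnit u) (h : !![u * a, u * b; u * c, u * d] ∈ Q) :
    !![a, b; c, d] ∈ Q := by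
  obtain ⟨u, rfl⟩ := hu
  convert hS ↑u⁻¹ _ (u⁻¹).isUnit h using 1
  ext i j
  fin_cases i <;> fin_cases j <;> simp

section

variable [TopologicalSpace R] [IsTopologicalRing R] [ContinuousSMul ℂ R]
  {Q : Submonoid (Matrix (Fin 2) (Fin 2) R)} {x : ℂ} {y v : R}

/-- The limits of `g(s) g(s')⁻¹` for `s, s' → 1` form a torus. -/
theorem torus_mem (hQ : LimitClosed Q)
    (hS : ∀ (u : R) (A : Matrix (Fin 2) (Fin 2) R), IsUnit u → A ∈ Q → u • A ∈ Q)
    (hx1 : x ≠ 1) (hv : y = v + κ x) (hvu : IsUnit v)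
    (hM : ∀ s s' : ℂ, s ≠ 0 → s ≠ 1 → s ≠ x → s' ≠ 0 → s' ≠ 1 → s' ≠ x →
      !![1, 0; -κ (1 - x), v] * (curveMatrix x y s * (curveMatrix x y s').adjugate) *
      !![v, 0; κ (1 - x), 1] ∈ Q) (l : ℂ) (hl : l ≠ 0) : !![κ l, 0; 0, 1] ∈ Q := by
  have hκ : Continuous κ := continuous_algebraMap ℂ R
  -- This is the conjugated product for s = 1 + lδ, s' = 1 + δ, divided by δ. At δ = 0 it equals (1
  -- - x)v² · diag(l, 1).
  have key := hQ (fun δ =>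
    !![κ l * (1 + κ δ - κ x) * (v * (1 + κ l * κ δ) - κ x * (1 - κ l) * κ δ) * v
        + (κ x * y * κ l * κ δ ^ 2 * (1 - κ l)) * (1 - κ x),
      κ x * y * κ l * κ δ ^ 2 * (1 - κ l);
      v * (-v * ((1 + κ l * κ δ - κ x) * (1 + κ δ - κ x) * (1 - κ l)) - (1 - κ x) *
        (κ l * (1 + κ δ - κ x) * (v * (1 + κ l * κ δ) - κ x * (1 - κ l) * κ δ))) +
        (1 - κ x) * (v * ((1 + κ l * κ δ - κ x) * (v * (1 + κ l * κ δ) + y * (1 - κ l) * κ δ))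
          - (1 - κ x) * (κ x * y * κ l * κ δ ^ 2 * (1 - κ l))),
      v * ((1 + κ l * κ δ - κ x) * (v * (1 + κ l * κ δ) + y * (1 - κ l) * κ δ))
          - (1 - κ x) * (κ x * y * κ l * κ δ ^ 2 * (1 - κ l))])
    (fun δ => l * (1 + l * δ) * (1 + δ) * (1 + l * δ - x) * (1 + δ - x)) (v ^ 4)
    (continuous_matrix_two (by fun_prop) (by fun_prop) (by fun_prop) (by fun_prop))
    (by fun_prop) (by simpa [hl, sub_eq_zero] using hx1.symm) (hvu.pow 4)
    (fun δ => by
      simp only [Matrix.det_fin_two_of, map_one, map_mul, map_add, map_sub, hv]; ring) ?_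
  · have hu : IsUnit ((1 - κ x) * v ^ 2) := by
      refine IsUnit.mul ?_ (hvu.pow 2)
      rw [← map_one κ, ← map_sub]
      exact (sub_ne_zero.2 hx1.symm).isUnit.map κ
    refine mem_of_mul_mem hS hu ?_
    convert key using 1
    simp only [map_zero]
    refine matrix_two_congr ?_ ?_ ?_ ?_ <;> ring
  · filter_upwards [self_mem_nhdsWithin, eventually_shift_ne 1 0 l hl,
      eventually_shift_ne 1 1 l hl, eventually_shift_ne 1 x l hl,
      eventually_shift_ne 1 0 1 one_ne_zero, eventually_shift_ne 1 1 1 one_ne_zero,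
      eventually_shift_ne 1 x 1 one_ne_zero] with δ hδ h1 h2 h3 h4 h5 h6
    have hδ : δ ≠ 0 := hδ
    have hmem := hM _ _ h1 h2 h3 h4 h5 h6
    rw [show 1 + 1 * δ = (1 + l * δ) + (1 - l) * δ by ring,
      conj_curveMatrix_mul_adjugate x y v hv] at hmem
    refine mem_of_mul_mem hS (hδ.isUnit.map κ) ?_
    convert hmem using 1
    simp only [map_mul, map_add, map_sub, map_one, hv]
    refine matrix_two_congr ?_ ?_ ?_ ?_ <;> ring

/-- The limit of a conjugate of `g(s) g(s')⁻¹` by a diverging element of the torus, for `s' → s`,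
is an upper unipotent element. -/
theorem upper_mem (hQ : LimitClosed Q)
    (hS : ∀ (u : R) (A : Matrix (Fin 2) (Fin 2) R), IsUnit u → A ∈ Q → u • A ∈ Q)
    (hv : y = v + κ x) (hvu : IsUnit v) (hT : ∀ l : ℂ, l ≠ 0 → !![κ l, 0; 0, 1] ∈ Q)
    (hM : ∀ s s' : ℂ, s ≠ 0 → s ≠ 1 → s ≠ x → s' ≠ 0 → s' ≠ 1 → s' ≠ x →
      !![1, 0; -κ (1 - x), v] * (curveMatrix x y s * (curveMatrix x y s').adjugate) *
      !![v, 0; κ (1 - x), 1] ∈ Q) {s : ℂ} (h0 : s ≠ 0) (h1 : s ≠ 1) (hsx : s ≠ x) {q : R}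
    (hq : κ (s * (s - 1) * (s - x)) * v ^ 2 * q = κ x * y * (κ s - 1) ^ 2) :
    q ∈ upper Q hT := by
  have hκ : Continuous κ := continuous_algebraMap ℂ R
  have hp : s * (s - 1) * (s - x) ≠ 0 :=
    mul_ne_zero (mul_ne_zero h0 (sub_ne_zero.2 h1)) (sub_ne_zero.2 hsx)
  -- Conjugation by diag(δ⁻¹, 1) removes the factor δ from the upper right entry and puts δ² in the
  -- lower left one. Here s' = s + δ.
  have key := hQ (fun δ =>
    !![(κ s - 1) * (κ s + κ δ - κ x) * (v * κ s - κ x * κ δ) * v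
        + κ δ * (κ x * y * (κ s - 1) * (κ s + κ δ - 1)) * (1 - κ x),
      κ x * y * (κ s - 1) * (κ s + κ δ - 1);
      κ δ ^ 2 * (-v ^ 2 * (κ s - κ x) * (κ s + κ δ - κ x)
        + v * (1 - κ x) * ((κ s - κ x) * ((κ s - 1) * y + κ s * v + y * κ δ)
          - (κ s - 1) * (-(κ s - κ x) * κ x + κ s * v - κ x * κ δ))
        - (1 - κ x) ^ 2 * (κ x * y * (κ s - 1) * (κ s + κ δ - 1))),
      v * ((κ s - κ x) * (κ s + κ δ - 1) * (v * κ s + y * κ δ))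
        - (1 - κ x) * κ δ * (κ x * y * (κ s - 1) * (κ s + κ δ - 1))])
    (fun δ => (s * (s - 1) * (s - x)) * ((s + δ) * (s + δ - 1) * (s + δ - x))) (v ^ 4)
    (continuous_matrix_two (by fun_prop) (by fun_prop) (by fun_prop) (by fun_prop))
    (by fun_prop) (by simpa using hp) (hvu.pow 4)
    (fun δ => by
      simp only [Matrix.det_fin_two_of, map_one, map_mul, map_add, map_sub, hv]; ring) ?_
  · refine mem_of_mul_mem hS ((hp.isUnit.map κ).mul (hvu.pow 2)) ?_
    rw [hq]
    convert key using 1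
    simp only [map_zero, map_mul, map_sub, map_one]
    refine matrix_two_congr ?_ ?_ ?_ ?_ <;> ring
  · filter_upwards [self_mem_nhdsWithin, eventually_shift_ne s 0 1 one_ne_zero,
      eventually_shift_ne s 1 1 one_ne_zero, eventually_shift_ne s x 1 one_ne_zero]
      with δ hδ h4 h5 h6
    have hδ : δ ≠ 0 := hδ
    have hu : κ δ * κ δ⁻¹ = 1 := by rw [← map_mul, mul_inv_cancel₀ hδ, map_one]
    have hmem := hM _ _ h0 h1 hsx h4 h5 h6
    rw [one_mul, conj_curveMatrix_mul_adjugate x y v hv] at hmem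
    convert conj_torus_mem hT (inv_ne_zero hδ) hmem using 1
    rw [inv_inv]
    refine matrix_two_congr (by ring) ?_ (by ring) (by ring)
    linear_combination -(κ x * y * (κ s - 1) * (κ s + κ δ - 1)) * hu

/-- The limit of a conjugate of `g(s) g(s')⁻¹` by a diverging element of the torus, for `s' → s`,
is a lower unipotent element. -/
theorem lower_mem (hQ : LimitClosed Q)
    (hS : ∀ (u : R) (A : Matrix (Fin 2) (Fin 2) R), IsUnit u → A ∈ Q → u • A ∈ Q)
    (hv : y = v + κ x) (hvu : IsUnit v) (hT : ∀ l : ℂ, l ≠ 0 → !![κ l, 0; 0, 1] ∈ Q)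
    (hM : ∀ s s' : ℂ, s ≠ 0 → s ≠ 1 → s ≠ x → s' ≠ 0 → s' ≠ 1 → s' ≠ x →
      !![1, 0; -κ (1 - x), v] * (curveMatrix x y s * (curveMatrix x y s').adjugate) *
      !![v, 0; κ (1 - x), 1] ∈ Q) {s : ℂ} (h0 : s ≠ 0) (h1 : s ≠ 1) (hsx : s ≠ x) {r : R}
    (hr : κ (s * (s - 1) * (s - x)) * v ^ 2 * r = κ ((s - 1) * x) * ((y - 1) *
      (y * κ (2 * x - 1 - s) + κ ((2 * x - x ^ 2) * s - x ^ 2)))) :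
    r ∈ lower Q hT := by
  have hκ : Continuous κ := continuous_algebraMap ℂ R
  have hp : s * (s - 1) * (s - x) ≠ 0 :=
    mul_ne_zero (mul_ne_zero h0 (sub_ne_zero.2 h1)) (sub_ne_zero.2 hsx)
  -- The same with diag(δ, 1), which exchanges the roles of the two off-diagonal entries.
  have key := hQ (fun δ =>
    !![(κ s - 1) * (κ s + κ δ - κ x) * (v * κ s - κ x * κ δ) * v
        + κ δ * (κ x * y * (κ s - 1) * (κ s + κ δ - 1)) * (1 - κ x),
      κ δ ^ 2 * (κ x * y * (κ s - 1) * (κ s + κ δ - 1));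
      -v ^ 2 * (κ s - κ x) * (κ s + κ δ - κ x)
        + v * (1 - κ x) * ((κ s - κ x) * ((κ s - 1) * y + κ s * v + y * κ δ)
          - (κ s - 1) * (-(κ s - κ x) * κ x + κ s * v - κ x * κ δ))
        - (1 - κ x) ^ 2 * (κ x * y * (κ s - 1) * (κ s + κ δ - 1)),
      v * ((κ s - κ x) * (κ s + κ δ - 1) * (v * κ s + y * κ δ))
        - (1 - κ x) * κ δ * (κ x * y * (κ s - 1) * (κ s + κ δ - 1))])
    (fun δ => (s * (s - 1) * (s - x)) * ((s + δ) * (s + δ - 1) * (s + δ - x))) (v ^ 4)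
    (continuous_matrix_two (by fun_prop) (by fun_prop) (by fun_prop) (by fun_prop))
    (by fun_prop) (by simpa using hp) (hvu.pow 4)
    (fun δ => by
      simp only [Matrix.det_fin_two_of, map_one, map_mul, map_add, map_sub, hv]; ring) ?_
  · refine mem_of_mul_mem hS ((hp.isUnit.map κ).mul (hvu.pow 2)) ?_
    rw [hr]
    convert key using 1
    simp only [map_zero, map_mul, map_sub, map_one, map_pow, map_ofNat, hv]
    refine matrix_two_congr ?_ ?_ ?_ ?_ <;> ring
  · filter_upwards [self_mem_nhdsWithin, eventually_shift_ne s 0 1 one_ne_zero,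
      eventually_shift_ne s 1 1 one_ne_zero, eventually_shift_ne s x 1 one_ne_zero]
      with δ hδ h4 h5 h6
    have hδ : δ ≠ 0 := hδ
    have hu : κ δ * κ δ⁻¹ = 1 := by rw [← map_mul, mul_inv_cancel₀ hδ, map_one]
    have hmem := hM _ _ h0 h1 hsx h4 h5 h6
    rw [one_mul, conj_curveMatrix_mul_adjugate x y v hv] at hmem
    convert conj_torus_mem hT hδ hmem using 1
    refine matrix_two_congr (by ring) (by ring) ?_ (by ring)
    rw [← mul_assoc (κ δ⁻¹), mul_comm (κ δ⁻¹) (κ δ), hu, one_mul]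

end

/-- The subgroup generated by the quotients of elements of the curve, made closed under limits,
is everything. -/
theorem mem_of_curve_mem [TopologicalSpace R] [IsTopologicalRing R] [ContinuousSMul ℂ R]
    [Module.Finite ℂ R]
    (hsr : ∀ a c : R, IsCoprime a c → ∃ r, IsUnit (a + r * c))
    (hsq : ∀ u : R, IsUnit u → ∃ w, w ^ 2 = u)
    {P : Submonoid (Matrix (Fin 2) (Fin 2) R)} (hP : LimitClosed P)
    (hS : ∀ u : R, IsUnit u → !![u, 0; 0, u] ∈ P)
    {x : ℂ} (hx0 : x ≠ 0) (hx1 : x ≠ 1) {y : R} (hy : Algebra.adjoin ℂ {y} = ⊤)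
    (hy0 : IsUnit y) (hy1 : IsUnit (y - 1)) (hyx : IsUnit (y - κ x))
    (hM : ∀ s s' : ℂ, s ≠ 0 → s ≠ 1 → s ≠ x → s' ≠ 0 → s' ≠ 1 → s' ≠ x →
      curveMatrix x y s * (curveMatrix x y s').adjugate ∈ P)
    {A : Matrix (Fin 2) (Fin 2) R} (hA : IsUnit A.det) : A ∈ P := by
  have hκ : Continuous κ := continuous_algebraMap ℂ R
  have hκu : ∀ a : ℂ, a ≠ 0 → IsUnit (κ a) := fun a ha => ha.isUnit.map κ
  obtain ⟨v, hv⟩ := hyx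
  have hxy : y = v + κ x := by rw [hv]; ring
  have hdeth : IsUnit (!![(v : R), 0; κ (1 - x), 1]).det := by
    simp [Matrix.det_fin_two_of]
  set h : GL (Fin 2) R := Matrix.GeneralLinearGroup.mk'' _ hdeth with hh
  have hhv : h.val = !![(v : R), 0; κ (1 - x), 1] := rfl
  set Q := conjSubmonoid h P with hQ
  have hQl : LimitClosed Q := hP.conj h
  have hQS : ∀ (u : R) (A : Matrix (Fin 2) (Fin 2) R), IsUnit u → A ∈ Q → u • A ∈ Q :=
    fun u A hu hA => by
    have := P.mul_mem (hS u hu) hA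
    rw [hQ, mem_conjSubmonoid]
    convert this using 1
    rw [show !![u, 0; 0, u] = u • (1 : Matrix (Fin 2) (Fin 2) R) by
      ext i j; fin_cases i <;> fin_cases j <;> simp]
    simp
  have hQconj : ∀ A ∈ P, !![1, 0; -κ (1 - x), (v : R)] * A * !![(v : R), 0; κ (1 - x), 1] ∈ Q :=
    fun A hA => by
    have h1 : !![1, 0; -κ (1 - x), (v : R)] = (v : R) • h⁻¹.val := by
      have : h.val * !![1, 0; -κ (1 - x), (v : R)] = (v : R) • 1 := by
        rw [hhv, Matrix.mul_fin_two, Matrix.one_fin_two]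
        ext i j; fin_cases i <;> fin_cases j <;> simp
      calc _ = h⁻¹.val * (h.val * !![1, 0; -κ (1 - x), (v : R)]) := by
            rw [← mul_assoc, ← Units.val_mul, inv_mul_cancel, Units.val_one, one_mul]
        _ = _ := by rw [this, mul_smul_comm, mul_one]
    rw [h1, smul_mul_assoc, smul_mul_assoc]
    refine hQS _ _ v.isUnit ?_
    rw [← hhv, hQ, mem_conjSubmonoid]
    convert hA using 1
    simp only [mul_assoc]
    rw [← Units.val_mul, mul_inv_cancel, Units.val_one, mul_one, ← mul_assoc, ← Units.val_mul,
      mul_inv_cancel, Units.val_one, one_mul]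
  have hQM : ∀ s s' : ℂ, s ≠ 0 → s ≠ 1 → s ≠ x → s' ≠ 0 → s' ≠ 1 → s' ≠ x →
      !![1, 0; -κ (1 - x), (v : R)] * (curveMatrix x y s * (curveMatrix x y s').adjugate) *
      !![(v : R), 0; κ (1 - x), 1] ∈ Q :=
    fun s s' h1 h2 h3 h4 h5 h6 => hQconj _ (hM s s' h1 h2 h3 h4 h5 h6)
  have hT := torus_mem hQl hQS hx1 hxy v.isUnit hQM
  set w : R := ↑v⁻¹ with hw
  have hvw : v ^ 2 * w ^ 2 = 1 := by rw [← mul_pow, hw, v.mul_inv, one_pow]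
  have hwu : IsUnit w := v⁻¹.isUnit
  -- The lower unipotents found below depend affinely on s up to a nonzero constant, so two
  -- parameters recover both coefficients.
  obtain ⟨s₁, s₂, hs, h10, h11, h1x, h20, h21, h2x⟩ : ∃ s₁ s₂ : ℂ, s₁ ≠ s₂ ∧ s₁ ≠ 0 ∧ s₁ ≠ 1 ∧
      s₁ ≠ x ∧ s₂ ≠ 0 ∧ s₂ ≠ 1 ∧ s₂ ≠ x := by
    obtain ⟨s₁, h1⟩ := Infinite.exists_notMem_finset ({0, 1, x} : Finset ℂ)
    obtain ⟨s₂, h2⟩ := Infinite.exists_notMem_finset ({0, 1, x, s₁} : Finset ℂ)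
    simp only [Finset.mem_insert, Finset.mem_singleton, not_or] at h1 h2
    exact ⟨s₁, s₂, Ne.symm h2.2.2.2, h1.1, h1.2.1, h1.2.2, h2.1, h2.2.1, h2.2.2.1⟩
  have he : y * w ^ 2 ∈ upper Q hT := by
    have hs1 := sub_ne_zero.2 h11
    have hsx := sub_ne_zero.2 h1x
    have hmem := upper_mem hQl hQS hxy v.isUnit hT hQM h10 h11 h1x
      (q := κ (x * (s₁ - 1) / (s₁ * (s₁ - x))) * (y * w ^ 2)) (by
        have : κ (s₁ * (s₁ - 1) * (s₁ - x)) * κ (x * (s₁ - 1) / (s₁ * (s₁ - x)))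
            = κ x * (κ s₁ - 1) ^ 2 := by
          rw [← map_mul, ← map_one κ, ← map_sub, ← map_pow, ← map_mul]
          congr 1
          field_simp
        linear_combination (v ^ 2 * w ^ 2 * y) * this + κ x * (κ s₁ - 1) ^ 2 * y * hvw)
    rw [← Algebra.smul_def] at hmem
    refine ((upper Q hT).smul_mem_iff ?_).1 hmem
    exact div_ne_zero (mul_ne_zero hx0 hs1) (mul_ne_zero h10 hsx)
  have hr : ∀ s : ℂ, s ≠ 0 → s ≠ 1 → s ≠ x → (y - 1) * w ^ 2 *
      (y * κ (2 * x - 1 - s) + κ ((2 * x - x ^ 2) * s - x ^ 2)) ∈ lower Q hT :=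
    fun s h0 h1 h2 => by
    have hs1 := sub_ne_zero.2 h1
    have hsx := sub_ne_zero.2 h2
    have hmem := lower_mem hQl hQS hxy v.isUnit hT hQM h0 h1 h2
      (r := κ (x / (s * (s - x))) * ((y - 1) * w ^ 2 *
      (y * κ (2 * x - 1 - s) + κ ((2 * x - x ^ 2) * s - x ^ 2)))) (by
        have : κ (s * (s - 1) * (s - x)) * κ (x / (s * (s - x))) = κ ((s - 1) * x) := by
          rw [← map_mul]
          congr 1
          field_simp
        linear_combination (v ^ 2 * w ^ 2 * ((y - 1) *
          (y * κ (2 * x - 1 - s) + κ ((2 * x - x ^ 2) * s - x ^ 2)))) * this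
          + κ ((s - 1) * x) * ((y - 1) *
          (y * κ (2 * x - 1 - s) + κ ((2 * x - x ^ 2) * s - x ^ 2))) * hvw)
    rw [← Algebra.smul_def] at hmem
    exact ((lower Q hT).smul_mem_iff (div_ne_zero hx0 (mul_ne_zero h0 hsx))).1 hmem
  set z := (y - 1) * w ^ 2 with hz
  have hβ : z * (y + κ (x ^ 2 - 2 * x)) ∈ lower Q hT := by
    refine ((lower Q hT).smul_mem_iff (sub_ne_zero.2 hs.symm)).1 ?_
    convert sub_mem (hr s₁ h10 h11 h1x) (hr s₂ h20 h21 h2x) using 1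
    rw [Algebra.smul_def]
    simp only [map_mul, map_sub, map_pow, map_one, map_ofNat]
    ring
  have hγ : z * (y * κ (2 * x - 1) - κ (x ^ 2)) ∈ lower Q hT := by
    convert add_mem (hr s₁ h10 h11 h1x) ((lower Q hT).smul_mem s₁ hβ) using 1
    rw [Algebra.smul_def]
    simp only [map_mul, map_sub, map_pow, map_one, map_ofNat]
    ring
  -- The combination (2x-1)(y + x² - 2x) - ((2x-1)y - x²) eliminates y and leaves 2x(x-1)², which is
  -- nonzero.
  have hzl : z ∈ lower Q hT := by
    have : 2 * x * (x - 1) ^ 2 ≠ 0 :=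
      mul_ne_zero (mul_ne_zero two_ne_zero hx0) (pow_ne_zero 2 (sub_ne_zero.2 hx1))
    refine ((lower Q hT).smul_mem_iff this).1 ?_
    convert sub_mem ((lower Q hT).smul_mem (2 * x - 1) hβ) hγ using 1
    simp only [Algebra.smul_def, map_mul, map_sub, map_pow, map_one, map_ofNat]
    ring
  have hzy : z * y ∈ lower Q hT := by
    convert sub_mem hβ ((lower Q hT).smul_mem (x ^ 2 - 2 * x) hzl) using 1
    simp only [Algebra.smul_def]
    ring
  have hzu : IsUnit z := hy1.mul (hwu.pow 2)
  have hU := upper_eq_top hT hQl hy he (hy0.mul (hwu.pow 2)) hzl hzu hzy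
  have hL := lower_eq_top hT hQl hU hzl hzu
  have hB : h⁻¹.val * A * h.val ∈ Q := by
    refine mem_of_isUnit_det hsr hsq (fun u hu => ?_) (fun q => ?_) (fun r => ?_) ?_
    · convert hQS u 1 hu Q.one_mem using 1
      ext i j; fin_cases i <;> fin_cases j <;> simp
    · exact (mem_upper hT).1 (by rw [hU]; trivial)
    · exact (mem_lower hT).1 (by rw [hL]; trivial)
    · rwa [Matrix.det_mul, Matrix.det_mul, mul_right_comm, ← Matrix.det_mul, ← Units.val_mul,
        inv_mul_cancel, Units.val_one, Matrix.det_one, one_mul]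
  rw [hQ, mem_conjSubmonoid] at hB
  rwa [show h.val * (h⁻¹.val * A * h.val) * h⁻¹.val
    = (h.val * h⁻¹.val) * A * (h.val * h⁻¹.val) by simp only [mul_assoc], ← Units.val_mul,
    mul_inv_cancel, Units.val_one, one_mul, mul_one] at hB

end

/-! ### The truncated polynomial rings ℂ[ε] -/

theorem algebraMap_eq_const (n : ℕ) : algebraMap ℂ (TruncPoly n) = const n := rfl

/-- The coefficients of an element of `ℂ[ε]`, as a linear equivalence. -/
def coeffsEquiv (n : ℕ) : TruncPoly n ≃ₗ[ℂ] (Fin (n + 1) → ℂ) :=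
  ((AdjoinRoot.powerBasisAux' (Polynomial.monic_X_pow (R := ℂ) (n + 1))).reindex
    (finCongr (Polynomial.natDegree_X_pow (n + 1)))).equivFun

theorem coeffsEquiv_apply (n : ℕ) (u : TruncPoly n) : coeffsEquiv n u = coeffs n u := by
  ext j
  simp [coeffsEquiv, coeffs]

instance (n : ℕ) : Module.Finite ℂ (TruncPoly n) :=
  Module.Finite.equiv (coeffsEquiv n).symm

/-- Identifies the coefficient topology with the canonical one of a finite ℂ-module, from which
continuity of the ring operations follows. -/
instance (n : ℕ) : IsModuleTopology ℂ (TruncPoly n) := by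
  have h0 : ⇑(coeffsEquiv n) = coeffs n := funext (coeffsEquiv_apply n)
  have h1 : Continuous (coeffsEquiv n) := h0 ▸ continuous_induced_dom
  have h2 : Continuous (coeffsEquiv n).symm := by
    refine continuous_induced_rng.2 ?_
    rw [← h0]
    convert continuous_id
    ext1 u
    exact (coeffsEquiv n).apply_symm_apply u
  exact IsModuleTopology.iso (R := ℂ)
    ({ (coeffsEquiv n).symm with continuous_toFun := h2, continuous_invFun := h1 } :
      (Fin (n + 1) → ℂ) ≃L[ℂ] TruncPoly n)

instance (n : ℕ) : IsTopologicalRing (TruncPoly n) := IsModuleTopology.isTopologicalRing ℂ _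

/-- The constant term of an element of `ℂ[ε]`. -/
def residue (n : ℕ) : TruncPoly n →+* ℂ :=
  AdjoinRoot.lift (RingHom.id ℂ) 0 (by simp)

theorem residue_const (n : ℕ) (c : ℂ) : residue n (const n c) = c := by
  simp [residue, const]

theorem residue_eps (n : ℕ) : residue n (eps n) = 0 := by
  simp [residue, eps]

theorem isNilpotent_sub_residue (n : ℕ) (u : TruncPoly n) :
    IsNilpotent (u - const n (residue n u)) := by
  induction u using AdjoinRoot.induction_on with
  | _ p =>
    have : AdjoinRoot.mk _ p - const n (residue n (AdjoinRoot.mk _ p)) =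
        AdjoinRoot.mk (Polynomial.X ^ (n + 1) : ℂ[X]) (p - Polynomial.C (p.eval 0)) := by
      simp [residue, const, Polynomial.coeff_zero_eq_eval_zero]
    rw [this]
    obtain ⟨q, hq⟩ : Polynomial.X ∣ p - Polynomial.C (p.eval 0) := by
      rw [Polynomial.X_dvd_iff, Polynomial.coeff_zero_eq_eval_zero]
      simp
    rw [hq, map_mul]
    refine (Commute.all _ _).isNilpotent_mul_right ⟨n + 1, ?_⟩
    rw [← AdjoinRoot.root.eq_1]
    exact eps_pow n

theorem isUnit_iff_residue_ne_zero (n : ℕ) {u : TruncPoly n} : IsUnit u ↔ residue n u ≠ 0 := by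
  refine ⟨fun h => (h.map (residue n)).ne_zero, fun h => ?_⟩
  have := (isNilpotent_sub_residue n u).isUnit_add_left_of_commute
    (h.isUnit.map (const n)) (Commute.all _ _)
  simpa using this

/-- A square root of the constant term lifts by Newton's method: 2c is a unit and the error is
nilpotent. -/
theorem exists_sq_eq (n : ℕ) {u : TruncPoly n} (hu : IsUnit u) : ∃ w, w ^ 2 = u := by
  obtain ⟨c, hc⟩ := IsAlgClosed.exists_pow_nat_eq (residue n u) (n := 2) two_pos
  have hc0 : c ≠ 0 := by
    rintro rfl
    exact (isUnit_iff_residue_ne_zero n).1 hu (by simpa using hc.symm)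
  obtain ⟨w, ⟨_, hw⟩, _⟩ := Polynomial.existsUnique_nilpotent_sub_and_aeval_eq_zero
    (P := (Polynomial.X ^ 2 - Polynomial.C u : (TruncPoly n)[X])) (x := const n c) (by
      rw [← isNilpotent_neg_iff]
      simpa [← map_pow, hc] using isNilpotent_sub_residue n u) (by
      rw [isUnit_iff_residue_ne_zero]
      simp [residue_const, hc0])
  exact ⟨w, by simpa [sub_eq_zero] using hw⟩

/-! ### The product ring ∏ ℂ[εᵢ] -/

section Pi

variable {ι : Type} (n : ι → ℕ)

theorem pi_exists_sq_eq {u : ∀ i, TruncPoly (n i)} (hu : IsUnit u) : ∃ w, w ^ 2 = u := by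
  choose w hw using fun i => exists_sq_eq (n i) (Pi.isUnit_iff.1 hu i)
  exact ⟨w, funext hw⟩

theorem pi_exists_isUnit_add_mul {a c : ∀ i, TruncPoly (n i)} (h : IsCoprime a c) :
    ∃ r, IsUnit (a + r * c) := by
  classical
  -- A factor is local, so r need only be 1 where a has residue 0; there coprimality forces c to be
  -- a unit.
  refine ⟨fun i => if residue (n i) (a i) = 0 then 1 else 0, Pi.isUnit_iff.2 fun i => ?_⟩
  rw [isUnit_iff_residue_ne_zero]
  obtain ⟨p, q, hpq⟩ := h
  have := congrArg (residue (n i)) (congrFun hpq i)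
  by_cases h0 : residue (n i) (a i) = 0
  · intro hc
    simp [h0] at hc
    simp [h0, hc] at this
  · simp [h0]

/-- The element `(tᵢ + εᵢ)ᵢ` of `∏ᵢ ℂ[εᵢ]`. -/
def piParam (t : ι → ℂ) : ∀ i, TruncPoly (n i) := fun i => const (n i) (t i) + eps (n i)

/-- Chinese remainder theorem for the pairwise coprime (X - tᵢ)^(nᵢ+1): a polynomial congruent to
pᵢ(X - tᵢ) takes the value pᵢ(εᵢ) at tᵢ + εᵢ. -/
theorem adjoin_piParam [Finite ι] {t : ι → ℂ} (ht : Function.Injective t) :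
    Algebra.adjoin ℂ {piParam n t} = ⊤ := by
  cases nonempty_fintype ι
  rw [Algebra.adjoin_singleton_eq_range_aeval, eq_top_iff]
  intro u _
  choose p hp using fun i => AdjoinRoot.mk_surjective (u i)
  let I : ι → Ideal ℂ[X] := fun i => Ideal.span {(Polynomial.X - Polynomial.C (t i)) ^ (n i + 1)}
  have hI : Pairwise fun i j => IsCoprime (I i) (I j) := fun i j hij => by
    refine (Ideal.isCoprime_span_singleton_iff _ _).2 ?_
    exact (Polynomial.pairwise_coprime_X_sub_C ht hij).pow
  obtain ⟨Q, hQ⟩ := Ideal.pi_quotient_surjective hI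
    fun i => Ideal.Quotient.mk _ ((p i).comp (Polynomial.X - Polynomial.C (t i)))
  refine ⟨Q, funext fun i => ?_⟩
  obtain ⟨c, hc⟩ := Ideal.mem_span_singleton.1 (Ideal.Quotient.eq.1 (hQ i))
  have h1 : (Polynomial.aeval (piParam n t) Q) i = Polynomial.aeval (piParam n t i) Q := by
    exact (Polynomial.aeval_algHom_apply (Pi.evalAlgHom ℂ (fun i => TruncPoly (n i)) i)
      (piParam n t) Q).symm
  have hroot : piParam n t i - algebraMap ℂ _ (t i) = eps (n i) := by
    rw [algebraMap_eq_const, piParam, add_sub_cancel_left]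
  have h2 := congrArg (Polynomial.aeval (piParam n t i)) hc
  rw [map_mul, map_sub, map_pow, Polynomial.aeval_comp, map_sub, Polynomial.aeval_X,
    Polynomial.aeval_C, hroot, eps_pow, zero_mul, sub_eq_zero] at h2
  show (Polynomial.aeval (piParam n t) Q) i = u i
  rw [h1, h2, ← hp i]
  exact AdjoinRoot.aeval_eq _

end Pi

/-! ### Topology of PGL₂ and closed subgroups of GL₂ -/

instance (R : Type*) [CommRing R] [TopologicalSpace R] [IsTopologicalRing R] :
    IsTopologicalGroup PGL(2, R) :=
  inferInstanceAs (IsTopologicalGroup (GL (Fin 2) R ⧸ Subgroup.center (GL (Fin 2) R)))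

theorem continuous_mk {R : Type*} [CommRing R] [TopologicalSpace R] :
    Continuous (Matrix.ProjGenLinGroup.mk : GL (Fin 2) R → PGL(2, R)) :=
  continuous_coinduced_rng

theorem isOpenQuotientMap_mk {R : Type*} [CommRing R] [TopologicalSpace R] [IsTopologicalRing R] :
    IsOpenQuotientMap (Matrix.ProjGenLinGroup.mk : GL (Fin 2) R → PGL(2, R)) :=
  QuotientGroup.isOpenQuotientMap_mk (N := Subgroup.center (GL (Fin 2) R))

/-- The submonoid of matrices underlying a subgroup of the general linear group. -/
def matrixSubmonoid {R : Type*} [CommRing R] (K : Subgroup (GL (Fin 2) R)) :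
    Submonoid (Matrix (Fin 2) (Fin 2) R) :=
  K.toSubmonoid.map (Units.coeHom _)

theorem coe_mem_matrixSubmonoid {R : Type*} [CommRing R] {K : Subgroup (GL (Fin 2) R)}
    {A : GL (Fin 2) R} : A.val ∈ matrixSubmonoid K ↔ A ∈ K := by
  constructor
  · rintro ⟨B, hB, h⟩
    rwa [← Units.ext h]
  · exact fun h => ⟨A, h, rfl⟩

/-- Convergence in GL₂ requires convergence of the inverses too. The shape of the determinant
reduces this to continuity of inversion in ℂ, since the inverse is d(δ)⁻¹c⁻¹ times the adjugate. -/
theorem limitClosed_matrixSubmonoid {R : Type*} [CommRing R] [Algebra ℂ R] [TopologicalSpace R]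
    [IsTopologicalRing R] [ContinuousSMul ℂ R] {K : Subgroup (GL (Fin 2) R)}
    (hK : IsClosed (K : Set (GL (Fin 2) R))) : LimitClosed (matrixSubmonoid K) := by
  intro F d c hF hd h0 hc hdet hmem
  have hκ : Continuous (algebraMap ℂ R) := continuous_algebraMap ℂ R
  obtain ⟨c, rfl⟩ := hc
  have hinv : ∀ δ, d δ ≠ 0 → (F δ).det * (algebraMap ℂ R (d δ)⁻¹ * ↑c⁻¹) = 1 := fun δ hδ => by
    have h1 : algebraMap ℂ R (d δ) * algebraMap ℂ R (d δ)⁻¹ = 1 := by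
      rw [← map_mul, mul_inv_cancel₀ hδ, map_one]
    rw [hdet, mul_mul_mul_comm, h1, c.mul_inv, one_mul]
  -- Where d vanishes the lift is the arbitrary value 1; this does not happen near 0.
  have hex : ∀ δ, ∃ U : GL (Fin 2) R, d δ ≠ 0 → U.val = F δ ∧
      U⁻¹.val = (algebraMap ℂ R (d δ)⁻¹ * ↑c⁻¹) • (F δ).adjugate := fun δ => by
    by_cases hδ : d δ = 0
    · exact ⟨1, fun h => absurd hδ h⟩
    · exact ⟨⟨F δ, (algebraMap ℂ R (d δ)⁻¹ * ↑c⁻¹) • (F δ).adjugate,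
        by rw [mul_smul_comm, Matrix.mul_adjugate, smul_smul, mul_comm, hinv δ hδ, one_smul],
        by rw [smul_mul_assoc, Matrix.adjugate_mul, smul_smul, mul_comm, hinv δ hδ, one_smul]⟩,
        fun _ => ⟨rfl, rfl⟩⟩
  choose f hf using hex
  have hev : ∀ᶠ δ in 𝓝 (0 : ℂ), d δ ≠ 0 := hd.continuousAt.eventually_ne h0
  have hlim : Tendsto f (𝓝 0) (𝓝 (f 0)) := by
    rw [Units.isEmbedding_embedProduct.tendsto_nhds_iff]
    refine Tendsto.prodMk_nhds ?_ ?_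
    · refine (hF.tendsto 0).congr' ?_ |>.trans ?_
      · filter_upwards [hev] with δ hδ using (hf δ hδ).1.symm
      · rw [← (hf 0 h0).1]
    · refine (MulOpposite.continuous_op.tendsto _).comp ?_
      have : Tendsto (fun δ => (algebraMap ℂ R (d δ)⁻¹ * ↑c⁻¹) • (F δ).adjugate) (𝓝 0)
          (𝓝 ((algebraMap ℂ R (d 0)⁻¹ * ↑c⁻¹) • (F 0).adjugate)) := by
        refine Tendsto.smul ?_ (hF.matrix_adjugate.tendsto 0)
        refine Tendsto.mul_const _ ((hκ.tendsto _).comp ?_)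
        exact (hd.tendsto 0).inv₀ h0
      rw [← (hf 0 h0).2] at this
      refine this.congr' ?_
      filter_upwards [hev] with δ hδ using (hf δ hδ).2.symm
  have hmemf : ∀ᶠ δ in 𝓝[≠] (0 : ℂ), f δ ∈ K := by
    filter_upwards [hmem, nhdsWithin_le_nhds hev] with δ h1 h2
    rwa [← (hf δ h2).1, coe_mem_matrixSubmonoid] at h1
  rw [← (hf 0 h0).1, coe_mem_matrixSubmonoid]
  exact hK.mem_of_tendsto (hlim.mono_left nhdsWithin_le_nhds) hmemf

/-! ### Closed subgroups of ∏ PGL₂(ℂ[εᵢ]) containing the quotients of the curve -/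

section Prod

variable {k : ℕ} (n : Fin (k + 1) → ℕ)

/-- The projection from `GL₂` of the product ring to the product of the groups `PGL₂`. -/
def toProdPGL : GL (Fin 2) (∀ i, TruncPoly (n i)) →* ProdPGL n :=
  MonoidHom.pi fun i => (Matrix.ProjGenLinGroup.mk).comp
    (Matrix.GeneralLinearGroup.map (Pi.evalRingHom (fun i => TruncPoly (n i)) i))

theorem continuous_toProdPGL : Continuous (toProdPGL n) := by
  refine continuous_pi fun i => continuous_mk.comp ?_
  refine Continuous.units_map _ ?_
  exact continuous_id.matrix_map (continuous_apply i)

/-- Families of matrices as matrices over the product ring. -/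
def piMatrix (A : ∀ i, Matrix (Fin 2) (Fin 2) (TruncPoly (n i))) :
    Matrix (Fin 2) (Fin 2) (∀ i, TruncPoly (n i)) := fun a b i => A i a b

theorem piMatrix_mul (A B : ∀ i, Matrix (Fin 2) (Fin 2) (TruncPoly (n i))) :
    piMatrix n (fun i => A i * B i) = piMatrix n A * piMatrix n B := by
  ext a b i
  simp only [piMatrix, Matrix.mul_apply, Fin.sum_univ_two]
  rfl

theorem piMatrix_one : piMatrix n (fun _ => 1) = 1 := by
  ext a b i
  by_cases h : a = b
  · subst h
    simp only [piMatrix, Matrix.one_apply_eq]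
    rfl
  · simp only [piMatrix, Matrix.one_apply_ne h]
    rfl

theorem exists_toProdPGL (A : ∀ i, GL (Fin 2) (TruncPoly (n i))) :
    ∃ B : GL (Fin 2) (∀ i, TruncPoly (n i)),
      B.val = piMatrix n (fun i => (A i).val) ∧
        toProdPGL n B = fun i => Matrix.ProjGenLinGroup.mk (A i) := by
  refine ⟨⟨piMatrix n (fun i => (A i).val), piMatrix n (fun i => (A i)⁻¹.val), ?_, ?_⟩, rfl, ?_⟩
  · rw [← piMatrix_mul, ← piMatrix_one]
    exact congrArg _ (funext fun i => (A i).mul_inv)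
  · rw [← piMatrix_mul, ← piMatrix_one]
    exact congrArg _ (funext fun i => (A i).inv_mul)
  · funext i
    refine congrArg _ ?_
    ext a b
    rfl

theorem toProdPGL_scalar (u : (∀ i, TruncPoly (n i))ˣ) :
    toProdPGL n (Matrix.GeneralLinearGroup.scalar (Fin 2) u) = 1 := by
  funext i
  rw [Pi.one_apply, ← Matrix.ProjGenLinGroup.mk_scalar
    (Units.map (Pi.evalRingHom (fun i => TruncPoly (n i)) i).toMonoidHom u)]
  refine congrArg Matrix.ProjGenLinGroup.mk ?_
  ext a b
  by_cases h : a = b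
  · subst h; simp
  · simp [h]

variable {n} {t : Fin (k + 1) → ℂ} {x : ℂ}

theorem eq_top_of_isClosed (ht : Function.Injective t) (ht0 : ∀ i, t i ≠ 0) (ht1 : ∀ i, t i ≠ 1)
    (hx0 : x ≠ 0) (hx1 : x ≠ 1) (hx : ∀ i, x ≠ t i) {H : Subgroup (ProdPGL n)}
    (hH : IsClosed (H : Set (ProdPGL n)))
    (hg : ∀ s s' : Param x, gTuple n t x hx s * (gTuple n t x hx s')⁻¹ ∈ H) : H = ⊤ := by
  refine eq_top_iff.2 fun w _ => ?_
  choose A hA using fun i => Matrix.ProjGenLinGroup.mk_surjective (w i)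
  obtain ⟨B, -, hB⟩ := exists_toProdPGL n A
  set K := H.comap (toProdPGL n) with hK
  have hKc : IsClosed (K : Set (GL (Fin 2) (∀ i, TruncPoly (n i)))) :=
    hH.preimage (continuous_toProdPGL n)
  have hunit : ∀ c : ℂ, (∀ i, t i ≠ c) → IsUnit (piParam n t - algebraMap ℂ _ c) := fun c hc => by
    refine Pi.isUnit_iff.2 fun i => (isUnit_iff_residue_ne_zero _).2 ?_
    show residue (n i) (const (n i) (t i) + eps (n i) - const (n i) c) ≠ 0
    simpa [residue_const, residue_eps, sub_eq_zero] using hc i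
  have hS : ∀ u : ∀ i, TruncPoly (n i), IsUnit u → !![u, 0; 0, u] ∈ matrixSubmonoid K := by
    rintro _ ⟨u, rfl⟩
    have h1 : (Matrix.GeneralLinearGroup.scalar (Fin 2) u).val =
        !![(u : ∀ i, TruncPoly (n i)), 0; 0, (u : ∀ i, TruncPoly (n i))] := by
      ext a b : 2
      fin_cases a <;> fin_cases b <;> simp
    rw [← h1, coe_mem_matrixSubmonoid, hK, Subgroup.mem_comap, toProdPGL_scalar]
    exact H.one_mem
  have hcurve : ∀ s : Param x, ∃ C : GL (Fin 2) (∀ i, TruncPoly (n i)),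
      C.val = curveMatrix x (piParam n t) s ∧ toProdPGL n C = gTuple n t x hx s := fun s => by
    obtain ⟨C, hC, hC'⟩ := exists_toProdPGL n (fun i => Matrix.GeneralLinearGroup.mk''
      (gMatrix (n i) (t i) x s) (isUnit_det_gMatrix (n i) (hx i) s.2.1 s.2.2.1 s.2.2.2))
    refine ⟨C, hC.trans ?_, hC'⟩
    ext a b i
    fin_cases a <;> fin_cases b <;> rfl
  have hmem : B.val ∈ matrixSubmonoid K := by
    refine mem_of_curve_mem (fun a c => pi_exists_isUnit_add_mul n) (fun u => pi_exists_sq_eq n)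
      (limitClosed_matrixSubmonoid hKc) hS hx0 hx1 (adjoin_piParam n ht)
      (by simpa using hunit 0 ht0) (by simpa using hunit 1 ht1) (hunit x fun i => (hx i).symm)
      ?_ ((Matrix.isUnit_iff_isUnit_det _).1 B.isUnit)
    intro s s' h1 h2 h3 h4 h5 h6
    obtain ⟨C, hC, hCg⟩ := hcurve ⟨s, h1, h2, h3⟩
    obtain ⟨C', hC', hCg'⟩ := hcurve ⟨s', h4, h5, h6⟩
    have hCC : C * C'⁻¹ ∈ K := by
      rw [hK, Subgroup.mem_comap, map_mul, map_inv, hCg, hCg']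
      exact hg _ _
    have hdet := (Matrix.isUnit_iff_isUnit_det _).1 C'.isUnit
    have := (matrixSubmonoid K).mul_mem (coe_mem_matrixSubmonoid.2 hCC) (hS _ hdet)
    convert this using 1
    -- The scalar det C' turns C C'⁻¹ into C adj(C').
    have h7 : !![C'.val.det, 0; 0, C'.val.det] = C'.val * C'.val.adjugate := by
      rw [Matrix.mul_adjugate]
      ext a b : 2
      fin_cases a <;> fin_cases b <;> simp
    rw [h7, Units.val_mul, mul_assoc, ← mul_assoc C'⁻¹.val, C'.inv_mul, one_mul, hC, hC']
  rw [coe_mem_matrixSubmonoid, hK, Subgroup.mem_comap, hB] at hmem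
  rwa [funext hA] at hmem

end Prod

/-! ### Vanishing ideals of sets swept out by linear maps -/

section Affine

variable {σ : Type*} [Fintype σ] [DecidableEq σ]

/-- Composition of polynomial functions with a linear map. -/
def pullback (L : (σ → ℂ) →ₗ[ℂ] (σ → ℂ)) : MvPolynomial σ ℂ →ₐ[ℂ] MvPolynomial σ ℂ :=
  MvPolynomial.aeval fun c =>
    ∑ c', MvPolynomial.C (L (Pi.single c' 1) c) * MvPolynomial.X c'

theorem aeval_pullback (L : (σ → ℂ) →ₗ[ℂ] (σ → ℂ)) (v : σ → ℂ) (f : MvPolynomial σ ℂ) :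
    MvPolynomial.aeval v (pullback L f) = MvPolynomial.aeval (L v) f := by
  rw [pullback, ← AlgHom.comp_apply, MvPolynomial.comp_aeval]
  congr 2
  funext c
  simp only [map_sum, map_mul, MvPolynomial.aeval_C, MvPolynomial.aeval_X]
  conv_rhs => rw [pi_eq_sum_univ' v, map_sum]
  simp [mul_comm]

theorem eq_of_aeval_eq {τ : Type*} {f g : MvPolynomial τ ℂ}
    (h : ∀ v : τ → ℂ, MvPolynomial.aeval v f = MvPolynomial.aeval v g) : f = g :=
  MvPolynomial.funext fun v => by simpa [MvPolynomial.aeval_eq_eval] using h v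

/-- Composition of polynomial functions with an invertible linear map. -/
def pullbackEquiv (L : (σ → ℂ) ≃ₗ[ℂ] (σ → ℂ)) : MvPolynomial σ ℂ ≃ₐ[ℂ] MvPolynomial σ ℂ :=
  AlgEquiv.ofAlgHom (pullback L.toLinearMap) (pullback L.symm.toLinearMap)
    (AlgHom.ext fun f => eq_of_aeval_eq fun v => by simp [aeval_pullback])
    (AlgHom.ext fun f => eq_of_aeval_eq fun v => by simp [aeval_pullback])

theorem vanishingIdeal_image (L : (σ → ℂ) ≃ₗ[ℂ] (σ → ℂ)) (S : Set (σ → ℂ)) :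
    MvPolynomial.vanishingIdeal ℂ (L '' S) =
      (MvPolynomial.vanishingIdeal ℂ S).comap (pullbackEquiv L).toRingEquiv := by
  ext f
  rw [Ideal.mem_comap, MvPolynomial.mem_vanishingIdeal_iff, MvPolynomial.mem_vanishingIdeal_iff,
    Set.forall_mem_image]
  refine forall₂_congr fun v _ => ?_
  exact (Eq.congr_left (aeval_pullback L.toLinearMap v f)).symm

omit [DecidableEq σ] in
/-- If irreducible sets are obtained from each other by applying families of linear
automorphisms, the union stabilizes up to closure after at most as many steps as the dimension. -/
theorem exists_vanishingIdeal_eq {ι : Type*} (L : ι → (σ → ℂ) ≃ₗ[ℂ] (σ → ℂ))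
    (S : ℕ → Set (σ → ℂ)) (hS : ∀ N, S (N + 1) = ⋃ s, L s '' S N)
    (hprime : ∀ N, (MvPolynomial.vanishingIdeal ℂ (S N)).IsPrime) :
    ∃ N ≤ Fintype.card σ, ∀ s,
      MvPolynomial.vanishingIdeal ℂ (S (N + 1)) = MvPolynomial.vanishingIdeal ℂ (L s '' S N) := by
  classical
  by_contra! hcon
  -- Without stabilization the inclusion of primes is strict for some s, and the automorphism L s
  -- preserves height, so the height drops by at least one.
  have hstep : ∀ N ≤ Fintype.card σ, (MvPolynomial.vanishingIdeal ℂ (S (N + 1))).height + 1 ≤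
      (MvPolynomial.vanishingIdeal ℂ (S N)).height := fun N hN => by
    obtain ⟨s, hs⟩ := hcon N hN
    have hle : MvPolynomial.vanishingIdeal ℂ (S (N + 1)) ≤
        MvPolynomial.vanishingIdeal ℂ (L s '' S N) := by
      refine MvPolynomial.vanishingIdeal_anti_mono ?_
      rw [hS]
      exact Set.subset_iUnion (fun s => L s '' S N) s
    have := hprime (N + 1)
    have hlt := Ideal.height_strict_mono_of_isPrime (lt_of_le_of_ne hle hs)
    rw [vanishingIdeal_image, RingEquiv.height_comap] at hlt
    exact Order.add_one_le_of_lt hlt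
  have hall : ∀ N ≤ Fintype.card σ + 1, (MvPolynomial.vanishingIdeal ℂ (S N)).height + N ≤
      (MvPolynomial.vanishingIdeal ℂ (S 0)).height := fun N => by
    induction N with
    | zero => simp
    | succ N ih =>
      intro hN
      refine le_trans ?_ (ih (by omega))
      have := hstep N (by omega)
      calc _ = (MvPolynomial.vanishingIdeal ℂ (S (N + 1))).height + 1 + (N : ℕ∞) := by
            push_cast; ring
        _ ≤ _ := by gcongr
  -- The indices 0, …, card σ give card σ + 1 drops, one more than the Krull dimension permits.
  have h0 : ((MvPolynomial.vanishingIdeal ℂ (S 0)).height : WithBot ℕ∞) ≤ Fintype.card σ := by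
    have := Ideal.height_le_ringKrullDim_of_ne_top (hprime 0).ne_top
    rwa [MvPolynomial.ringKrullDim_of_isNoetherianRing, ringKrullDim_eq_zero_of_field, zero_add,
      Nat.card_eq_fintype_card] at this
  have h1 := (le_add_self.trans (hall _ le_rfl)).trans (by exact_mod_cast h0)
  have h2 : Fintype.card σ + 1 ≤ Fintype.card σ := by exact_mod_cast h1
  omega

omit [DecidableEq σ] in
/-- Sweeping an irreducible set along a polynomial curve of linear maps gives an irreducible set. -/
theorem isPrime_vanishingIdeal_iUnion {p : ℂ → Prop} (hp : {s | ¬ p s}.Finite)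
    (L : {s // p s} → (σ → ℂ) ≃ₗ[ℂ] (σ → ℂ)) (Q₀ Q₁ Q₂ : (σ → ℂ) → σ → ℂ)
    (hL : ∀ s v, L s v = Q₀ v + (s : ℂ) • Q₁ v + (s : ℂ) ^ 2 • Q₂ v) (S : Set (σ → ℂ))
    (hS : (MvPolynomial.vanishingIdeal ℂ S).IsPrime) :
    (MvPolynomial.vanishingIdeal ℂ (⋃ s, L s '' S)).IsPrime := by
  classical
  have hmem : ∀ f, f ∈ MvPolynomial.vanishingIdeal ℂ (⋃ s, L s '' S) ↔
      ∀ s, pullback (L s).toLinearMap f ∈ MvPolynomial.vanishingIdeal ℂ S := fun f => by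
    simp only [MvPolynomial.mem_vanishingIdeal_iff, aeval_pullback, Set.mem_iUnion,
      forall_exists_index, LinearEquiv.coe_coe]
    rw [forall_comm]
    exact forall_congr' fun s => Set.forall_mem_image
  -- For a point v ∈ S with f(L s₀ v) ≠ 0, the function s ↦ f(L s v) is a nonzero polynomial in s
  -- with finitely many roots. For f and g outside the ideal, one s then avoids both exceptional
  -- sets, and primality for S applies.
  have hfin : ∀ f, f ∉ MvPolynomial.vanishingIdeal ℂ (⋃ s, L s '' S) →
      {s : ℂ | ∃ h : p s, pullback (L ⟨s, h⟩).toLinearMap f ∈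
        MvPolynomial.vanishingIdeal ℂ S}.Finite := fun f hf => by
    rw [hmem] at hf
    push Not at hf
    obtain ⟨s₀, hs₀⟩ := hf
    rw [MvPolynomial.mem_vanishingIdeal_iff] at hs₀
    push Not at hs₀
    obtain ⟨v, hv, hne⟩ := hs₀
    let F : ℂ[X] := MvPolynomial.aeval (fun c => Polynomial.C (Q₀ v c) +
      Polynomial.X * Polynomial.C (Q₁ v c) + Polynomial.X ^ 2 * Polynomial.C (Q₂ v c)) f
    have hF : ∀ s : {s // p s}, F.eval (s : ℂ) =
        MvPolynomial.aeval v (pullback (L s).toLinearMap f) := fun s => by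
      rw [aeval_pullback, ← Polynomial.coe_aeval_eq_eval, ← AlgHom.comp_apply,
        MvPolynomial.comp_aeval]
      congr 2
      funext c
      simp [hL]
      ring
    have hF0 : F ≠ 0 := fun h => hne (by rw [← hF, h, Polynomial.eval_zero])
    refine (F.roots.toFinset.finite_toSet).subset ?_
    rintro s ⟨h, hs⟩
    simpa [hF0, hF ⟨s, h⟩] using hs v hv
  have hex : ∀ T : Set ℂ, T.Finite → ∃ s, p s ∧ s ∉ T := fun T hT => by
    obtain ⟨s, hs⟩ := (hp.union hT).infinite_compl.nonempty
    simp only [Set.mem_compl_iff, Set.mem_union, not_or, Set.mem_ofPred_eq, not_not] at hs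
    exact ⟨s, hs⟩
  refine Ideal.isPrime_iff.2 ⟨fun h => ?_, fun {f g} hfg => ?_⟩
  · obtain ⟨s, hs, -⟩ := hex ∅ Set.finite_empty
    have := (hmem 1).1 ((Ideal.eq_top_iff_one _).1 h) ⟨s, hs⟩
    rw [map_one] at this
    exact hS.ne_top ((Ideal.eq_top_iff_one _).2 this)
  · by_contra! hcon
    obtain ⟨s, hs, hsT⟩ := hex _ ((hfin f hcon.1).union (hfin g hcon.2))
    have := (hmem _).1 hfg ⟨s, hs⟩
    rw [map_mul] at this
    rcases hS.mem_or_mem this with h | h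
    · exact hsT (Or.inl ⟨hs, h⟩)
    · exact hsT (Or.inr ⟨hs, h⟩)

end Affine

/-! ### The cone of representatives of the image of `phi` -/

theorem residue_eq_coeffs_zero (n : ℕ) (u : TruncPoly n) : residue n u = coeffs n u 0 := by
  induction u using AdjoinRoot.induction_on with
  | _ p =>
    have h := congrArg (Polynomial.eval 0) (Polynomial.modByMonic_add_div p
      (Polynomial.X ^ (n + 1) : ℂ[X]))
    have h1 : residue n (AdjoinRoot.mk _ p) = p.eval 0 := by
      simp [residue, Polynomial.coeff_zero_eq_eval_zero]
    rw [h1, ← h]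
    simp [coeffs, Polynomial.coeff_zero_eq_eval_zero]

section Prod

variable {k : ℕ} (n : Fin (k + 1) → ℕ)

/-- The coordinates of a family of matrices, as a linear equivalence. -/
def coordsEquiv : (∀ i, Matrix (Fin 2) (Fin 2) (TruncPoly (n i))) ≃ₗ[ℂ] (Coord n → ℂ) where
  toFun A c := coeffsEquiv (n c.1) (A c.1 c.2.1 c.2.2.1) c.2.2.2
  invFun v i := Matrix.of fun a b => (coeffsEquiv (n i)).symm fun j => v ⟨i, a, b, j⟩
  map_add' A B := by ext c; simp
  map_smul' r A := by ext c; simp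
  left_inv A := by
    ext i a b
    exact (coeffsEquiv (n i)).symm_apply_apply (A i a b)
  right_inv v := by ext ⟨i, a, b, j⟩; simp

theorem coords_eq (A : ∀ i, GL (Fin 2) (TruncPoly (n i))) :
    coords n A = coordsEquiv n fun i => (A i).val := by
  ext c
  simp [coords, coordsEquiv, coeffsEquiv_apply]

theorem continuous_coords : Continuous (coords n) := by
  refine continuous_pi fun c => ?_
  have h : Continuous fun A : ∀ i, GL (Fin 2) (TruncPoly (n i)) => (A c.1).val c.2.1 c.2.2.1 :=
    (Units.continuous_val.comp (continuous_apply c.1)).matrix_elem _ _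
  have h' : Continuous (coeffs (n c.1)) := continuous_induced_dom
  exact (continuous_apply _).comp (h'.comp h)

/-- Right multiplication by a family of invertible matrices, in coordinates. -/
def rightMul (B : ∀ i, GL (Fin 2) (TruncPoly (n i))) : (Coord n → ℂ) ≃ₗ[ℂ] (Coord n → ℂ) :=
  (coordsEquiv n).symm ≪≫ₗ
    LinearEquiv.piCongrRight (fun i =>
      { toFun := fun A => A * (B i).val
        invFun := fun A => A * (B i)⁻¹.val
        map_add' := fun A A' => add_mul _ _ _
        map_smul' := fun c A => smul_mul_assoc _ _ _
        left_inv := fun A => by simp only; rw [mul_assoc, (B i).mul_inv, mul_one]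
        right_inv := fun A => by simp only; rw [mul_assoc, (B i).inv_mul, mul_one] }) ≪≫ₗ
    coordsEquiv n

theorem rightMul_coordsEquiv (B : ∀ i, GL (Fin 2) (TruncPoly (n i)))
    (A : ∀ i, Matrix (Fin 2) (Fin 2) (TruncPoly (n i))) :
    rightMul n B (coordsEquiv n A) = coordsEquiv n fun i => A i * (B i).val := by
  simp only [rightMul, LinearEquiv.trans_apply, LinearEquiv.symm_apply_apply]
  rfl

theorem rightMul_coords (A B : ∀ i, GL (Fin 2) (TruncPoly (n i))) :
    rightMul n B (coords n A) = coords n (A * B) := by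
  rw [coords_eq, rightMul_coordsEquiv, coords_eq]
  rfl

/-- The projection from `∏ᵢ GL₂` to `∏ᵢ PGL₂`. -/
def prodMk : (∀ i, GL (Fin 2) (TruncPoly (n i))) →* ProdPGL n :=
  MonoidHom.piMap fun _ => Matrix.ProjGenLinGroup.mk

theorem prodMk_surjective : Function.Surjective (prodMk n) := fun w => by
  choose A hA using fun i => Matrix.ProjGenLinGroup.mk_surjective (w i)
  exact ⟨A, funext hA⟩

theorem isOpenQuotientMap_prodMk : IsOpenQuotientMap (prodMk n) :=
  IsOpenQuotientMap.piMap fun _ => isOpenQuotientMap_mk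

theorem exists_of_isClosed_zariski {C : Set (ProdPGL n)} (hC : IsClosed[zariskiProdPGL n] C) :
    ∃ F : Set (MvPolynomial (Coord n) ℂ), ∀ A, prodMk n A ∈ C ↔
      ∀ f ∈ F, MvPolynomial.aeval (coords n A) f = 0 := by
  obtain ⟨T, hT, hTC⟩ := (@isClosed_induced_iff _ _ (zariskiAffine (Coord n)) _ _).1
    ((@isClosed_coinduced _ _ (zariskiProdGL n) _ _).1 hC)
  obtain ⟨Z, hZ, hZT⟩ := isClosed_induced_iff.1 hT
  obtain ⟨F, rfl⟩ := (PrimeSpectrum.isClosed_iff_zeroLocus _).1 hZ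
  refine ⟨F, fun A => ?_⟩
  have h1 : prodMk n A ∈ C ↔ coords n A ∈ T := (Set.ext_iff.1 hTC A).symm
  rw [h1, ← hZT]
  simp only [Set.mem_preimage, PrimeSpectrum.mem_zeroLocus]
  refine forall₂_congr fun f _ => ?_
  exact MvPolynomial.mem_vanishingIdeal_singleton_iff _ _

variable {n} (t : Fin (k + 1) → ℂ) (x : ℂ) (hx : ∀ i, x ≠ t i)

/-- The coordinates of the matrices that represent elements of the image of `phi`. -/
def phiCone (N : ℕ) : Set (Coord n → ℂ) :=
  coords n '' (prodMk n ⁻¹' Set.range (phi n t x hx N))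

/-- The family of invertible matrices that represents `g_{s, x}`. -/
def gLift (s : Param x) (i : Fin (k + 1)) : GL (Fin 2) (TruncPoly (n i)) :=
  Matrix.GeneralLinearGroup.mk'' (gMatrix (n i) (t i) x s)
    (isUnit_det_gMatrix (n i) (hx i) s.2.1 s.2.2.1 s.2.2.2)

theorem prodMk_gLift (s : Param x) : prodMk n (gLift t x hx s) = gTuple n t x hx s := rfl

theorem phi_succ (N : ℕ) (s : Fin (N + 1) → Param x) :
    phi n t x hx (N + 1) s =
      phi n t x hx N (fun j => s j.castSucc) * gTuple n t x hx (s (Fin.last N)) := by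
  rw [phi, List.ofFn_succ', List.concat_eq_append, List.prod_append, List.prod_singleton]
  rfl

/-- As the cone contains every representative, a single lift of each g(s) suffices. -/
theorem phiCone_succ (N : ℕ) :
    phiCone (n := n) t x hx (N + 1) =
      ⋃ s, rightMul n (gLift t x hx s) '' phiCone t x hx N := by
  ext v
  simp only [Set.mem_iUnion]
  constructor
  · rintro ⟨A, ⟨s, hs⟩, rfl⟩
    refine ⟨s (Fin.last N), coords n (A * (gLift t x hx (s (Fin.last N)))⁻¹),
      ⟨_, ⟨fun j => s j.castSucc, ?_⟩, rfl⟩, ?_⟩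
    · rw [map_mul, map_inv, ← hs, phi_succ, prodMk_gLift, mul_inv_cancel_right]
    · rw [rightMul_coords, inv_mul_cancel_right]
  · rintro ⟨s, _, ⟨A, ⟨s', hs'⟩, rfl⟩, rfl⟩
    refine ⟨A * gLift t x hx s, ⟨Fin.snoc s' s, ?_⟩, (rightMul_coords _ _ _).symm⟩
    rw [phi_succ, map_mul, prodMk_gLift, ← hs']
    simp

/-- The coordinates of a scalar matrix as polynomials in the coefficients of the scalars. -/
def scalarPullback : MvPolynomial (Coord n) ℂ →ₐ[ℂ] MvPolynomial (Σ i, Fin (n i + 1)) ℂ :=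
  MvPolynomial.aeval fun c => if c.2.1 = c.2.2.1 then MvPolynomial.X ⟨c.1, c.2.2.2⟩ else 0

theorem aeval_scalarPullback (v : (Σ i, Fin (n i + 1)) → ℂ) (f : MvPolynomial (Coord n) ℂ) :
    MvPolynomial.aeval v (scalarPullback f) = MvPolynomial.aeval (coordsEquiv n fun i =>
      Matrix.scalar (Fin 2) ((coeffsEquiv (n i)).symm fun j => v ⟨i, j⟩)) f := by
  rw [scalarPullback, ← AlgHom.comp_apply, MvPolynomial.comp_aeval]
  congr 2
  funext c
  by_cases h : c.2.1 = c.2.2.1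
  · simp [coordsEquiv, h]
  · simp [coordsEquiv, h]

/-- The cone consists of the invertible scalar matrices, a principal open subset of an affine space,
so primality comes from a polynomial ring being a domain. -/
theorem isPrime_vanishingIdeal_phiCone_zero :
    (MvPolynomial.vanishingIdeal ℂ (phiCone (n := n) t x hx 0)).IsPrime := by
  have hphi : ∀ s, phi n t x hx 0 s = 1 := fun s => by simp [phi]
  have hmem : ∀ u : ∀ i, (TruncPoly (n i))ˣ,
      coords n (fun i => Matrix.GeneralLinearGroup.scalar (Fin 2) (u i)) ∈
        phiCone t x hx 0 := fun u => by
    refine ⟨_, ⟨Fin.elim0, ?_⟩, rfl⟩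
    rw [hphi]
    exact funext fun i => (Matrix.ProjGenLinGroup.mk_scalar (u i)).symm
  have hne : ∀ f, f ∉ MvPolynomial.vanishingIdeal ℂ (phiCone (n := n) t x hx 0) →
      scalarPullback f ≠ 0 := fun f hf h0 => by
    rw [MvPolynomial.mem_vanishingIdeal_iff] at hf
    push Not at hf
    obtain ⟨_, ⟨A, ⟨s, hs⟩, rfl⟩, hA⟩ := hf
    rw [hphi] at hs
    have hs' : ∀ i, ∃ u, Matrix.GeneralLinearGroup.scalar (Fin 2) u = A i := fun i => by
      obtain ⟨u, hu⟩ := Matrix.ProjGenLinGroup.mk_eq_mk_iff.1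
        ((congrFun hs i : (1 : PGL(2, TruncPoly (n i))) = Matrix.ProjGenLinGroup.mk (A i)))
      exact ⟨u, by simpa using hu⟩
    choose u hu using hs'
    have := aeval_scalarPullback (fun c => coeffsEquiv (n c.1) (u c.1) c.2) f
    rw [h0, map_zero] at this
    apply hA
    rw [this, coords_eq]
    congr 3
    funext i
    have e : ((coeffsEquiv (n i)).symm fun j => coeffsEquiv (n i) (u i) j) = u i :=
      (coeffsEquiv (n i)).symm_apply_apply _
    rw [← hu i, e]
    ext a b
    simp
  refine Ideal.isPrime_iff.2 ⟨fun h => ?_, fun {f g} hfg => ?_⟩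
  · have := (MvPolynomial.mem_vanishingIdeal_iff.1 ((Ideal.eq_top_iff_one _).1 h)) _
      (hmem fun _ => 1)
    simp at this
  · by_contra! hcon
    -- The extra product of constant-term variables vanishes exactly at the non-invertible scalars,
    -- where nothing is known about fg.
    have h0 : scalarPullback f * scalarPullback g *
        ∏ i, MvPolynomial.X (⟨i, 0⟩ : Σ i, Fin (n i + 1)) ≠ 0 :=
      mul_ne_zero (mul_ne_zero (hne f hcon.1) (hne g hcon.2))
        (Finset.prod_ne_zero_iff.2 fun i _ => MvPolynomial.X_ne_zero _)
    apply h0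
    refine eq_of_aeval_eq fun v => ?_
    rw [map_zero, ← map_mul scalarPullback, map_mul, map_prod]
    simp only [MvPolynomial.aeval_X]
    by_cases hv : ∀ i, v ⟨i, 0⟩ ≠ 0
    · have hu : ∀ i, IsUnit ((coeffsEquiv (n i)).symm fun j => v ⟨i, j⟩) := fun i => by
        rw [isUnit_iff_residue_ne_zero, residue_eq_coeffs_zero, ← coeffsEquiv_apply]
        simpa using hv i
      choose u hu using hu
      have := hfg _ (hmem u)
      rw [aeval_scalarPullback]
      convert zero_mul _
      rw [← this, coords_eq]
      congr 3
      funext i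
      rw [← hu i]
      ext a b
      simp
    · push Not at hv
      obtain ⟨i, hi⟩ := hv
      rw [Finset.prod_eq_zero (Finset.mem_univ i) hi, mul_zero]

end Prod

/-- The curve is quadratic in s, the form that the sweeping argument takes as input. -/
theorem gMatrix_eq (n : ℕ) (t x s : ℂ) : gMatrix n t x s =
    !![const n x, 0; const n x, 0] + s • !![-const n x, -(const n t + eps n); -1, -const n x] +
      s ^ 2 • !![0, const n t + eps n; 0, 1] := by
  have h : ∀ (c : ℂ) (u : TruncPoly n), c • u = const n c * u := fun c u => Algebra.smul_def c u
  ext a b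
  fin_cases a <;> fin_cases b <;> simp [gMatrix, h] <;> ring

/-! ### Stabilization of the cones and Zariski density -/

section Prod

variable {k : ℕ} {n : Fin (k + 1) → ℕ} {t : Fin (k + 1) → ℂ} {x : ℂ} {hx : ∀ i, x ≠ t i}

theorem isPrime_vanishingIdeal_phiCone (N : ℕ) :
    (MvPolynomial.vanishingIdeal ℂ (phiCone (n := n) t x hx N)).IsPrime := by
  induction N with
  | zero => exact isPrime_vanishingIdeal_phiCone_zero t x hx
  | succ N ih =>
    rw [phiCone_succ]
    let Q (G : ∀ i, Matrix (Fin 2) (Fin 2) (TruncPoly (n i))) (v : Coord n → ℂ) : Coord n → ℂ :=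
      coordsEquiv n fun i => (coordsEquiv n).symm v i * G i
    refine isPrime_vanishingIdeal_iUnion
      (p := fun s => s ≠ 0 ∧ s ≠ 1 ∧ s ≠ x) ?_ (fun s => rightMul n (gLift t x hx s))
      (Q fun i => !![const (n i) x, 0; const (n i) x, 0])
      (Q fun i => !![-const (n i) x, -(const (n i) (t i) + eps (n i)); -1, -const (n i) x])
      (Q fun i => !![0, const (n i) (t i) + eps (n i); 0, 1]) (fun s v => ?_) _ ih
    · refine (Set.toFinite ({0, 1, x} : Set ℂ)).subset fun s hs => ?_
      simp only [Set.mem_insert_iff, Set.mem_singleton_iff]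
      by_contra hcon
      push Not at hcon
      exact hs hcon
    · obtain ⟨A, rfl⟩ := (coordsEquiv n).surjective v
      rw [rightMul_coordsEquiv]
      simp only [Q, LinearEquiv.symm_apply_apply, ← map_smul, ← map_add]
      congr 1
      funext i
      show A i * gMatrix (n i) (t i) x s = _
      rw [gMatrix_eq, mul_add, mul_add, mul_smul_comm, mul_smul_comm]
      rfl

/-- The elements of `∏ᵢ PGL₂` all of whose representatives lie in the Zariski closure of a set. -/
def coneLocus (S : Set (Coord n → ℂ)) : Set (ProdPGL n) :=
  {w | ∀ A, prodMk n A = w → coords n A ∈ MvPolynomial.zeroLocus ℂ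
    (MvPolynomial.vanishingIdeal ℂ S)}

/-- Closed in the usual topology: polynomials are continuous, and the representatives of a class are
the products A z with z in the kernel. -/
theorem isClosed_coneLocus (S : Set (Coord n → ℂ)) : IsClosed (coneLocus S) := by
  rw [← (isOpenQuotientMap_prodMk n).isQuotientMap.isClosed_preimage]
  have : prodMk n ⁻¹' coneLocus S = ⋂ f ∈ MvPolynomial.vanishingIdeal ℂ S,
      ⋂ z ∈ (prodMk n).ker, {A | MvPolynomial.aeval (coords n (A * z)) f = 0} := by
    ext A
    simp only [Set.mem_preimage, Set.mem_iInter, Set.mem_ofPred_eq]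
    constructor
    · intro hA f hf z hz
      exact hA (A * z) (by rw [map_mul, MonoidHom.mem_ker.1 hz, mul_one]) f hf
    · intro hA B hB f hf
      have := hA f hf (A⁻¹ * B) (by rw [MonoidHom.mem_ker, map_mul, hB, map_inv, inv_mul_cancel])
      rwa [mul_inv_cancel_left] at this
  rw [this]
  refine isClosed_biInter fun f _ => isClosed_biInter fun z _ => ?_
  have hc : Continuous fun A : ∀ i, GL (Fin 2) (TruncPoly (n i)) => coords n (A * z) :=
    (continuous_coords n).comp (continuous_id.mul continuous_const)
  refine isClosed_singleton.preimage (f := fun A => MvPolynomial.aeval (coords n (A * z)) f) ?_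
  simp only [MvPolynomial.aeval_eq_eval]
  exact (MvPolynomial.continuous_eval f).comp hc

theorem subset_coneLocus (N : ℕ) :
    Set.range (phi n t x hx N) ⊆ coneLocus (phiCone t x hx N) :=
  fun _ hw A hA => MvPolynomial.zeroLocus_vanishingIdeal_le _ ⟨A, by rwa [← hA] at hw, rfl⟩

/-- If Z_N is the closure of the N-th cone, the hypothesis says Z_{N+1} = Z_N g(s) for every s.
Hence Z_N g(s) = Z_N g(s'). -/
theorem mul_mem_coneLocus {N : ℕ} (h : ∀ s,
      MvPolynomial.vanishingIdeal ℂ (phiCone (n := n) t x hx (N + 1)) =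
        MvPolynomial.vanishingIdeal ℂ (rightMul n (gLift t x hx s) '' phiCone t x hx N))
    (s s' : Param x) {w : ProdPGL n} (hw : w ∈ coneLocus (phiCone t x hx N)) :
    w * (gTuple n t x hx s * (gTuple n t x hx s')⁻¹) ∈ coneLocus (phiCone t x hx N) := by
  intro B hB
  have hA := hw (B * (gLift t x hx s' * (gLift t x hx s)⁻¹)) (by
    rw [map_mul, hB, map_mul, map_inv, prodMk_gLift, prodMk_gLift]
    group)
  have hlocus : ∀ (s : Param x) (v : Coord n → ℂ),
      v ∈ MvPolynomial.zeroLocus ℂ (MvPolynomial.vanishingIdeal ℂ (phiCone t x hx N)) ↔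
      rightMul n (gLift t x hx s) v ∈ MvPolynomial.zeroLocus ℂ
        (MvPolynomial.vanishingIdeal ℂ (phiCone (n := n) t x hx (N + 1))) := fun s v => by
    rw [h s, vanishingIdeal_image]
    simp only [MvPolynomial.mem_zeroLocus_iff, Ideal.mem_comap]
    constructor
    · intro hv p hp
      have := hv _ hp
      rwa [show (pullbackEquiv (rightMul n (gLift t x hx s))).toRingEquiv p
        = pullback (rightMul n (gLift t x hx s)).toLinearMap p from rfl, aeval_pullback] at this
    · intro hv p hp
      obtain ⟨q, rfl⟩ := (pullbackEquiv (rightMul n (gLift t x hx s))).surjective p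
      have := hv q hp
      rwa [show pullbackEquiv (rightMul n (gLift t x hx s)) q
        = pullback (rightMul n (gLift t x hx s)).toLinearMap q from rfl, aeval_pullback]
  rw [hlocus s', rightMul_coords]
  rw [hlocus s, rightMul_coords] at hA
  convert hA using 2
  group

variable (n) in
theorem dense_closure_mul_inv (ht : Function.Injective t) (ht0 : ∀ i, t i ≠ 0)
    (ht1 : ∀ i, t i ≠ 1) (hx0 : x ≠ 0) (hx1 : x ≠ 1) (hx : ∀ i, x ≠ t i) :
    Dense (Subgroup.closure (Set.range fun p : Param x × Param x =>
      gTuple n t x hx p.1 * (gTuple n t x hx p.2)⁻¹) : Set (ProdPGL n)) := by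
  have := eq_top_of_isClosed ht ht0 ht1 hx0 hx1 hx
    (Subgroup.isClosed_topologicalClosure (Subgroup.closure (Set.range
      fun p : Param x × Param x => gTuple n t x hx p.1 * (gTuple n t x hx p.2)⁻¹)))
    (fun s s' => Subgroup.le_topologicalClosure _ (Subgroup.subset_closure ⟨(s, s'), rfl⟩))
  rw [dense_iff_closure_eq, ← Subgroup.topologicalClosure_coe, this, Subgroup.coe_top]

theorem exists_coneLocus_eq_univ (ht : Function.Injective t) (ht0 : ∀ i, t i ≠ 0)
    (ht1 : ∀ i, t i ≠ 1) (hx0 : x ≠ 0) (hx1 : x ≠ 1) :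
    ∃ N ≤ Fintype.card (Coord n), coneLocus (phiCone (n := n) t x hx N) = Set.univ := by
  obtain ⟨N, hN, h⟩ := exists_vanishingIdeal_eq _ _ (phiCone_succ (n := n) t x hx)
    isPrime_vanishingIdeal_phiCone
  refine ⟨N, hN, Set.eq_univ_of_forall fun w => ?_⟩
  set W := coneLocus (phiCone (n := n) t x hx N)
  have hx2 : ∃ s, s ∉ ({0, 1, x} : Finset ℂ) := Infinite.exists_notMem_finset _
  obtain ⟨s, hs⟩ := hx2
  simp only [Finset.mem_insert, Finset.mem_singleton, not_or] at hs
  obtain ⟨w₀, hw₀⟩ : W.Nonempty := ⟨_, subset_coneLocus N ⟨fun _ => ⟨s, hs⟩, rfl⟩⟩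
  -- The stabilizer is defined by an equivalence so that it is closed under inverses.
  let H : Subgroup (ProdPGL n) :=
    { carrier := {g | ∀ w, w ∈ W ↔ w * g ∈ W}
      one_mem' := fun w => by rw [mul_one]
      mul_mem' := fun {a b} ha hb w => by rw [← mul_assoc, ← hb, ← ha]
      inv_mem' := fun {a} ha w => by rw [ha (w * a⁻¹), inv_mul_cancel_right] }
  have hH : Subgroup.closure (Set.range fun p : Param x × Param x =>
      gTuple n t x hx p.1 * (gTuple n t x hx p.2)⁻¹) ≤ H := by
    rw [Subgroup.closure_le]
    rintro _ ⟨⟨s, s'⟩, rfl⟩ w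
    refine ⟨mul_mem_coneLocus h s s', fun hw => ?_⟩
    have := mul_mem_coneLocus h s' s hw
    convert this using 1
    group
  have hcl : IsClosed {g | w₀ * g ∈ W} :=
    (isClosed_coneLocus _).preimage (continuous_const.mul continuous_id)
  -- The orbit of w₀ under a dense subgroup stays in the closed set W, so W is everything.
  have hall := hcl.closure_subset_iff.2 fun g hg => (hH hg w₀).1 hw₀
  rw [(dense_closure_mul_inv n ht ht0 ht1 hx0 hx1 hx).closure_eq] at hall
  have : w₀ * (w₀⁻¹ * w) ∈ W := hall (Set.mem_univ (w₀⁻¹ * w))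
  rwa [mul_inv_cancel_left] at this

/-- The next cone contains a translate of the present one by an invertible linear map. -/
theorem coneLocus_succ_eq_univ {N : ℕ}
    (h : coneLocus (phiCone (n := n) t x hx N) = Set.univ) (s : Param x) :
    coneLocus (phiCone (n := n) t x hx (N + 1)) = Set.univ := by
  refine Set.eq_univ_of_forall fun w A hA => ?_
  have hle : MvPolynomial.vanishingIdeal ℂ (phiCone (n := n) t x hx (N + 1)) ≤
      MvPolynomial.vanishingIdeal ℂ (rightMul n (gLift t x hx s) '' phiCone t x hx N) := by
    rw [phiCone_succ]
    exact MvPolynomial.vanishingIdeal_anti_mono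
      (Set.subset_iUnion (fun s => rightMul n (gLift t x hx s) '' phiCone t x hx N) s)
  refine MvPolynomial.zeroLocus_anti_mono hle ?_
  have hB := (Set.eq_univ_iff_forall.1 h _) (A * (gLift t x hx s)⁻¹) rfl
  rw [vanishingIdeal_image]
  intro p hp
  have := hB _ hp
  rwa [show (pullbackEquiv (rightMul n (gLift t x hx s))).toRingEquiv p
    = pullback (rightMul n (gLift t x hx s)).toLinearMap p from rfl, aeval_pullback,
    LinearEquiv.coe_coe, rightMul_coords, inv_mul_cancel_right] at this

theorem card_coord : Fintype.card (Coord n) = 4 * ∑ i, (n i + 1) := by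
  simp only [Fintype.card_sigma, Fintype.card_prod, Fintype.card_fin, Finset.mul_sum]
  exact Finset.sum_congr rfl fun i _ => by ring

/-- Equations cutting out C upstairs vanish on the cone, hence on its Zariski closure, which
contains every representative. -/
theorem eq_univ_of_isClosed_zariski {N : ℕ}
    (h : coneLocus (phiCone (n := n) t x hx N) = Set.univ) {C : Set (ProdPGL n)}
    (hC : IsClosed[zariskiProdPGL n] C) (hsub : Set.range (phi n t x hx N) ⊆ C) :
    C = Set.univ := by
  obtain ⟨F, hF⟩ := exists_of_isClosed_zariski n hC
  refine Set.eq_univ_of_forall fun w => ?_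
  obtain ⟨A, rfl⟩ := prodMk_surjective n w
  refine (hF A).2 fun f hf => (Set.eq_univ_iff_forall.1 h _) A rfl f ?_
  rintro _ ⟨B, hB, rfl⟩
  exact (hF B).1 (hsub hB) f hf

end Prod

end WildHecke

end

theorem lemma3p10 (k : ℕ) (n : Fin (k + 1) → ℕ) (t : Fin (k + 1) → ℂ)
    (ht : Function.Injective t) (ht0 : ∀ i, t i ≠ 0) (ht1 : ∀ i, t i ≠ 1)
    (x : ℂ) (hx0 : x ≠ 0) (hx1 : x ≠ 1) (hx : ∀ i, x ≠ t i) :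
    Dense (Subgroup.closure (Set.range (WildHecke.gTuple n t x hx)) : Set (WildHecke.ProdPGL n)) ∧
    ∀ m : ℕ, m = (∑ i, (n i + 1)) + 1 →
      @DenseRange (WildHecke.ProdPGL n) (WildHecke.zariskiProdPGL n) (Fin (4 * m) → WildHecke.Param x)
        (WildHecke.phi n t x hx (4 * m)) := by
  constructor
  · refine (WildHecke.dense_closure_mul_inv n ht ht0 ht1 hx0 hx1 hx).mono ?_
    refine (Subgroup.closure_le _).2 ?_
    rintro _ ⟨p, rfl⟩
    exact mul_mem (Subgroup.subset_closure ⟨p.1, rfl⟩)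
      (inv_mem (Subgroup.subset_closure ⟨p.2, rfl⟩))
  · rintro m rfl
    obtain ⟨N, hN, h⟩ := WildHecke.exists_coneLocus_eq_univ (n := n) (hx := hx) ht ht0 ht1 hx0 hx1
    rw [WildHecke.card_coord] at hN
    obtain ⟨s, hs⟩ := Infinite.exists_notMem_finset ({0, 1, x} : Finset ℂ)
    simp only [Finset.mem_insert, Finset.mem_singleton, not_or] at hs
    have hall : ∀ j, WildHecke.coneLocus (WildHecke.phiCone (n := n) t x hx (N + j)) = Set.univ :=
      fun j => by
      induction j with
      | zero => exact h
      | succ j ih => exact WildHecke.coneLocus_succ_eq_univ ih ⟨s, hs⟩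
    -- Stabilization occurs at some N ≤ 4∑(nᵢ+1), so 4m leaves room to spare.
    obtain ⟨j, hj⟩ := Nat.exists_eq_add_of_le (show N ≤ 4 * (∑ i, (n i + 1) + 1) by omega)
    have hfin := hall j
    rw [← hj] at hfin
    let := WildHecke.zariskiProdPGL n
    rw [DenseRange, dense_iff_closure_eq]
    exact WildHecke.eq_univ_of_isClosed_zariski hfin isClosed_closure subset_closure
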